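/- Let $J\ge2$ and $d\ge1$ be integers and $I:=dJ$. A generalized Futurity slot machine has cam positions $i\in\mathbf Z/I\mathbf Z$ and pointer positions $0,1,\dots,J-1$. In cam position $i$ the payout has a distribution on $[0,\infty)$ with bounded support, probability $p_i\in(0,1)$ of being nonzero, mean $\mu_i$ and variance $\sigma_i^2$; let $q_i:=1-p_i$. All these parameters are extended periodically to $i\in\mathbf Z$. Successive payouts (without awards) are independent, and the cam advances by one position (mod $I$) with each coup. The pointer advances by $1$ after a loss (payout $0$) and resets to $0$ after a win, or after a loss in position $J-1$; in the latter case an award of $J$ additional coins is paid (the Futurity award). Put $Q:=q_0q_1\cdots q_{I-1}$ and, for $k\ge 0$, $w_i(k):=q_iq_{i-1}\cdots q_{i-kJ+1}\,p_{i-kJ}$, and $$P_i:=\frac1{1-Q}\sum_{k=1}^d w_i(k),\qquad \mu^*:=\frac1I\sum_{i=0}^{I-1}\mu_i+\frac{J}{I(1-Q)}\sum_{i=0}^{I-1}\sum_{k=1}^d w_i(k).$$ Let $\Delta_{ij}:=1$ if $i\equiv j\pmod J$ and $\Delta_{ij}:=0$ otherwise. For $1\le i<j\le I$ let $$A_{ij}:=J\mu_{i-1}\Bigl(\sum_{1\le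 k<(j-i)/J}w_{j-1}(k)+\Delta_{ij}\,q_{j-1}\cdots q_i-P_{j-1}\Bigr)+J^2\Bigl(\sum_{1\le k<(j-i)/J}w_{j-1}(k)P_{i-1}+\Delta_{ij}\sum_{k>(j-i)/J}w_{j-1}(k)-P_{i-1}P_{j-1}\Bigr),$$ and for $1\le i,j\le I$ let (an empty product being $1$) $$B_{ij}:=\mu_{i-1}\Bigl(-P_{j-1}+\sum_{1\le k<d+(j-i)/J}w_{j-1}(k)+\Delta_{ij}\,q_{I-1}\cdots q_i\,q_{j-1}\cdots q_0\Bigr),$$ $$C_{ij}:=-P_{i-1}P_{j-1}+\sum_{1\le k<d+(j-i)/J}w_{j-1}(k)P_{i-1}+\Delta_{ij}\sum_{k>d+(j-i)/J}w_{j-1}(k).$$ Define $$V:=\sum_{i=0}^{I-1}\bigl[\sigma_i^2-2J\mu_iP_i+J^2P_i(1-P_i)\bigr]+2\sum_{1\le i<j\le I}A_{ij},\qquad K:=\frac{J}{1-Q}\sum_{i=1}^I\sum_{j=1}^I(B_{ij}+JC_{ij}),\qquad (\sigma^*)^2:=\frac{V+2K}{I}.$$ (a) Let $(R_n)_{n\in\mathbf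 Z}$ be independent, $R_n$ having the payout distribution of cam position $n-1$ (mod $I$); let $R_n^*:=R_n+J\sum_{k\ge1}1_{\{R_{n-kJ}>0,\ R_{n-kJ+1}=\cdots=R_n=0\}}$ and $S_m^*:=R_{mI+1}^*+\cdots+R_{(m+1)I}^*$. Then $\mathrm E[S_0^*]=I\mu^*$, $\operatorname{Var}(S_0^*)=V$ and $\sum_{m=1}^\infty\operatorname{Cov}(S_0^*,S_m^*)=K$ (the series converges), so that $I(\sigma^*)^2=\operatorname{Var}(S_0^*)+2\sum_{m\ge1}\operatorname{Cov}(S_0^*,S_m^*)$; moreover $(\sigma^*)^2>0$. (b) Let $\hat R_1^*,\hat R_2^*,\dots$ be the sequence of payouts of the machine, including the Futurity awards, starting in an arbitrary initial state $(i_0,j_0)$ (cam position $i_0$, pointer position $j_0$). Then $$\frac{\hat R_1^*+\cdots+\hat R_n^*-n\mu^*}{\sqrt{n(\sigma^*)^2}}\ \xrightarrow{\ d\ }\ N(0,1)\qquad(n\to\infty).$$ -/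

import Mathlib

open MeasureTheory ProbabilityTheory Filter

noncomputable section

/-- A generalized one-armed Futurity machine whose cam has `d * J` positions and which pays `J` coins
after `J` consecutive losses. Cam positions are residues modulo `d * J`, so every parameter indexed
by a cam position is automatically extended periodically. `law i` is the distribution of the payout
(without the Futurity award) in cam position `i`. -/
structure FuturityMachine (d J : ℕ) where
  law : ZMod (d * J) → Measure ℝ
  isProbabilityMeasure_law : ∀ i, IsProbabilityMeasure (law i)
  payout_nonneg : ∀ i, ∀ᵐ x ∂(law i), 0 ≤ x
  payout_bounded : ∃ M : ℝ, ∀ i, ∀ᵐ x ∂(law i), x ≤ M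
  win_pos : ∀ i, 0 < (law i).real (Set.Ioi 0)
  win_lt_one : ∀ i, (law i).real (Set.Ioi 0) < 1

namespace FuturityMachine

variable {d J : ℕ} (M : FuturityMachine d J) {Ω : Type*} [MeasurableSpace Ω]

/-! ### The basic parameters -/

/-- `p_i`, the probability of a nonzero payout in cam position `i`. -/
def p (i : ZMod (d * J)) : ℝ := (M.law i).real (Set.Ioi 0)

/-- `q_i = 1 - p_i`. -/
def q (i : ZMod (d * J)) : ℝ := 1 - M.p i

/-- `μ_i`, the mean payout in cam position `i`. -/
def mean (i : ZMod (d * J)) : ℝ := ∫ x, x ∂(M.law i)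

/-- `σ_i²`, the variance of the payout in cam position `i`. -/
def var (i : ZMod (d * J)) : ℝ := Var[fun x : ℝ => x; M.law i]

/-- `Q = q_0 q_1 ⋯ q_{I-1}`, where `I = d * J`. -/
def Q : ℝ := ∏ i ∈ Finset.range (d * J), M.q (i : ZMod (d * J))

/-- `q_i q_{i-1} ⋯ q_{i-kJ+1} p_{i-kJ}`. -/
def run (i : ZMod (d * J)) (k : ℕ) : ℝ :=
  (∏ m ∈ Finset.range (k * J), M.q (i - (m : ZMod (d * J)))) * M.p (i - ((k * J : ℕ) : ZMod (d * J)))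

/-- `p° = (I (1 - Q))⁻¹ ∑_{i=0}^{I-1} ∑_{k=1}^d q_i ⋯ q_{i-kJ+1} p_{i-kJ}`. -/
def pCirc : ℝ :=
  (∑ i ∈ Finset.range (d * J), ∑ k ∈ Finset.Icc 1 d, M.run (i : ZMod (d * J)) k) /
    (((d * J : ℕ) : ℝ) * (1 - M.Q))

/-- `μ* = I⁻¹ ∑_{i=0}^{I-1} μ_i + J p°`. -/
def muStar : ℝ :=
  (∑ i ∈ Finset.range (d * J), M.mean (i : ZMod (d * J))) / ((d * J : ℕ) : ℝ) + J * M.pCirc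

/-- `P_i = (1 - Q)⁻¹ ∑_{k=1}^d q_i ⋯ q_{i-kJ+1} p_{i-kJ}`. -/
def award (i : ZMod (d * J)) : ℝ := (∑ k ∈ Finset.Icc 1 d, M.run i k) / (1 - M.Q)

/-- `Δ_{ij}`, which is `1` if `i ≡ j (mod J)` and `0` otherwise. -/
def delta (J i j : ℕ) : ℝ := if i ≡ j [MOD J] then 1 else 0

/-- `A_{ij}` for `1 ≤ i < j ≤ I`. The condition `k < (j - i) / J` is written `k * J + i < j`. -/
def coeffA (i j : ℕ) : ℝ :=
  J * M.mean ((i : ZMod (d * J)) - 1) *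
      ((∑ k ∈ Finset.Icc 1 d with k * J + i < j, M.run ((j : ZMod (d * J)) - 1) k)
        + delta J i j * (∏ m ∈ Finset.Ico i j, M.q (m : ZMod (d * J)))
        - M.award ((j : ZMod (d * J)) - 1))
    + (J : ℝ) ^ 2 *
      ((∑ k ∈ Finset.Icc 1 d with k * J + i < j, M.run ((j : ZMod (d * J)) - 1) k)
          * M.award ((i : ZMod (d * J)) - 1)
        + delta J i j * (∑' k : ℕ, if j < k * J + i then M.run ((j : ZMod (d * J)) - 1) k else 0)
        - M.award ((i : ZMod (d * J)) - 1) * M.award ((j : ZMod (d * J)) - 1))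

/-- `B_{ij}` for `1 ≤ i, j ≤ I`. The condition `k < d + (j - i) / J` is written
`k * J + i < d * J + j`; it forces `k < 2 * d`. -/
def coeffB (i j : ℕ) : ℝ :=
  M.mean ((i : ZMod (d * J)) - 1) *
    (-M.award ((j : ZMod (d * J)) - 1)
      + (∑ k ∈ Finset.Icc 1 (2 * d) with k * J + i < d * J + j, M.run ((j : ZMod (d * J)) - 1) k)
      + delta J i j * (∏ m ∈ Finset.Ico i (d * J), M.q (m : ZMod (d * J)))
          * (∏ m ∈ Finset.range j, M.q (m : ZMod (d * J))))

/-- `C_{ij}` for `1 ≤ i, j ≤ I`. -/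
def coeffC (i j : ℕ) : ℝ :=
  -(M.award ((i : ZMod (d * J)) - 1) * M.award ((j : ZMod (d * J)) - 1))
    + (∑ k ∈ Finset.Icc 1 (2 * d) with k * J + i < d * J + j, M.run ((j : ZMod (d * J)) - 1) k)
        * M.award ((i : ZMod (d * J)) - 1)
    + delta J i j *
        (∑' k : ℕ, if d * J + j < k * J + i then M.run ((j : ZMod (d * J)) - 1) k else 0)

/-- The explicit value of `Var(S_0*)`. -/
def varFormula : ℝ :=
  (∑ i ∈ Finset.range (d * J),
      (M.var (i : ZMod (d * J)) - 2 * J * M.mean (i : ZMod (d * J)) * M.award (i : ZMod (d * J))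
        + (J : ℝ) ^ 2 * M.award (i : ZMod (d * J)) * (1 - M.award (i : ZMod (d * J)))))
    + 2 * ∑ j ∈ Finset.Icc 1 (d * J), ∑ i ∈ Finset.Ico 1 j, M.coeffA i j

/-- The explicit value of `∑_{m ≥ 1} Cov(S_0*, S_m*)`. -/
def covSumFormula : ℝ :=
  J / (1 - M.Q) * ∑ i ∈ Finset.Icc 1 (d * J), ∑ j ∈ Finset.Icc 1 (d * J),
    (M.coeffB i j + J * M.coeffC i j)

/-- `(σ*)²`, i.e. `I⁻¹` times the sum of `Var(S_0*)` and twice the sum of the covariances. -/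
def sigmaStarSq : ℝ := (M.varFormula + 2 * M.covSumFormula) / ((d * J : ℕ) : ℝ)

/-! ### The machine running forever, with time indexed by the integers -/

/-- Payouts without Futurity awards over all integer times: they are independent, and the payout of
coup `n` has the distribution belonging to cam position `n - 1`. -/
structure IsBiinfinitePayouts (P : Measure Ω) (R : ℤ → Ω → ℝ) : Prop where
  measurable : ∀ n, Measurable (R n)
  indep : iIndepFun R P
  map_eq : ∀ n, P.map (R n) = M.law (((n - 1 : ℤ)) : ZMod (d * J))

/-- At coup `n` a Futurity award is paid: that coup completes a string of exactly `k * J` consecutive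
losses, for some `k ≥ 1`. -/
def awardEvent (J : ℕ) (R : ℤ → Ω → ℝ) (n : ℤ) : Set Ω :=
  {ω | ∃ k : ℕ, 1 ≤ k ∧ 0 < R (n - ((k * J : ℕ) : ℤ)) ω ∧ ∀ m : ℕ, m < k * J → R (n - (m : ℤ)) ω = 0}

/-- `R_n*`, the payout of coup `n` including the Futurity award. -/
def biPayoutStar (J : ℕ) (R : ℤ → Ω → ℝ) (n : ℤ) (ω : Ω) : ℝ :=
  R n ω + (awardEvent J R n).indicator (fun _ => (J : ℝ)) ω

/-- `S_m* = R_{mI+1}* + ⋯ + R_{(m+1)I}*` with `I = d * J`. -/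
def blockStar (d J : ℕ) (R : ℤ → Ω → ℝ) (m : ℤ) (ω : Ω) : ℝ :=
  ∑ j ∈ Finset.Icc 1 (d * J), biPayoutStar J R (m * ((d * J : ℕ) : ℤ) + (j : ℤ)) ω

/-! ### The machine started in a given state -/

/-- Payouts without Futurity awards when the initial cam position is `i₀`; `R n` is the payout of
coup `n + 1`, before which the cam is in position `i₀ + n`. -/
structure IsPayoutsFrom (i₀ : ZMod (d * J)) (P : Measure Ω) (R : ℕ → Ω → ℝ) : Prop where
  measurable : ∀ n, Measurable (R n)
  indep : iIndepFun R P
  map_eq : ∀ n, P.map (R n) = M.law (i₀ + (n : ZMod (d * J)))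

/-- The pointer position `Y_n` after `n` coups with payouts `r 0, …, r (n - 1)`, starting in `j₀`. It
advances by one after a loss and resets to `0` after a win, or after a loss in position `J - 1`. -/
def pointer (J j₀ : ℕ) (r : ℕ → ℝ) : ℕ → ℕ
  | 0 => j₀
  | n + 1 => if r n = 0 then (if pointer J j₀ r n = J - 1 then 0 else pointer J j₀ r n + 1) else 0

/-- The payout of coup `n + 1` including the Futurity award: `J` additional coins are paid if
the pointer is in position `J - 1` before that coup and the coup is lost. -/
def payoutStar (J j₀ : ℕ) (r : ℕ → ℝ) (n : ℕ) : ℝ :=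
  r n + if pointer J j₀ r n = J - 1 ∧ r n = 0 then (J : ℝ) else 0

end FuturityMachine

end

/-! A win erases all memory of the pointer, so the stationary payout of a coup depends only on the
coups back to the last win. Dependence therefore decays geometrically: a full turn of the cam
without a win has probability `Q`.

Moments. The award event of a coup is the disjoint union, over `k`, of the events `streak` of
exactly `k * J` losses. The covariance of an earlier quantity with an award is computed streak by
streak (`hasSum_cov_awardInd`). Streaks that begin after the earlier coup are independent of it and
contribute nothing; inside a longer streak the earlier coup is a loss, and divisibility by `J`
decides whether it pays an award. The result is `lagCov`, and `coeffA_eq_lagCov` and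
`coeffBC_eq_lagCov` identify it with the stated coefficients. One more turn of the cam multiplies
`lagCov` by `Q`, so the block covariances form a geometric series.

Positivity. The centred payout of the first coup of each block, restricted to the event that both
neighbouring coups win, is orthogonal to everything else in the block sums. This bounds the variance
of `N` blocks from below by a positive multiple of `N` (`le_variance_sum_blockStar`), whereas
`tendsto_variance_sum_blockStar` gives its exact growth rate.

Central limit theorem. Cut time into blocks of `b` turns and reset the pointer to `0` at the start
of each. The resulting block payouts `fresh` are independent and identically distributed, so the
classical theorem applies to them. The discrepancy `carry` with the stationary payouts is at most `2
* J` per block by the pathwise coupling `abs_sum_payoutStar_sub_le`, and it decorrelates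
exponentially. Hence the sum of `N` carries has variance at most a constant times `N`, with a
constant free of `b` (`variance_sum_carry_le`). After normalization it contributes `O(b^(-1/2))` in
`L¹`. Letting `n → ∞` and then `b → ∞` in the characteristic functions proves the theorem; by the
same coupling, the initial pointer position costs only a bounded amount. -/

noncomputable section

namespace FuturityMachine

/-! ### Loss products, award probabilities and their periodicity in the cam -/

section Parameters

variable {d J : ℕ} (M : FuturityMachine d J)

instance (i : ZMod (d * J)) : IsProbabilityMeasure (M.law i) := M.isProbabilityMeasure_law i

lemma p_pos (i : ZMod (d * J)) : 0 < M.p i := M.win_pos i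

lemma q_pos (i : ZMod (d * J)) : 0 < M.q i := sub_pos.2 (M.win_lt_one i)

lemma q_lt_one (i : ZMod (d * J)) : M.q i < 1 := sub_lt_self _ (M.p_pos i)

lemma p_le_one (i : ZMod (d * J)) : M.p i ≤ 1 := (M.win_lt_one i).le

lemma law_real_singleton_zero (i : ZMod (d * J)) : (M.law i).real {0} = M.q i := by
  have h1 : (M.law i).real ({0} ∪ Set.Ioi 0) = 1 := by
    rw [measureReal_def, (prob_compl_eq_zero_iff
      ((measurableSet_singleton _).union measurableSet_Ioi)).1, ENNReal.toReal_one]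
    refine measure_mono_null ?_ (ae_iff.1 (M.payout_nonneg i))
    intro x hx
    simp only [Set.mem_compl_iff, Set.mem_union, Set.mem_singleton_iff, Set.mem_Ioi, not_or,
      Set.mem_ofPred_eq] at hx ⊢
    grind
  rw [measureReal_union (by simp) measurableSet_Ioi] at h1
  rw [q, p]
  linarith

lemma memLp_two_law (i : ZMod (d * J)) : MemLp (fun x : ℝ => x) 2 (M.law i) := by
  obtain ⟨C, hC⟩ := M.payout_bounded
  refine MemLp.of_bound (by fun_prop) C ?_
  filter_upwards [hC i, M.payout_nonneg i] with x h1 h2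
  rwa [Real.norm_of_nonneg h2]

/-- The law charges both `{0}` and the open half-line, so it cannot be concentrated at its mean. -/
lemma var_pos (i : ZMod (d * J)) : 0 < M.var i := by
  refine lt_of_le_of_ne (variance_nonneg _ _) fun h => ?_
  have h0 := ae_eq_integral_of_variance_eq_zero (M.memLp_two_law i) h.symm
  have hz : ∃ᵐ x ∂(M.law i), x ∈ ({0} : Set ℝ) := by
    rw [frequently_ae_mem_iff]
    intro h
    have := M.q_pos i
    rw [← M.law_real_singleton_zero, measureReal_def, h] at this
    simp at this
  have hp : ∃ᵐ x ∂(M.law i), x ∈ Set.Ioi (0 : ℝ) := by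
    rw [frequently_ae_mem_iff]
    intro h
    have := M.p_pos i
    rw [p, measureReal_def, h] at this
    simp at this
  obtain ⟨x, hx, hx'⟩ := (hz.and_eventually h0).exists
  obtain ⟨y, hy, hy'⟩ := (hp.and_eventually h0).exists
  simp only [Set.mem_singleton_iff, Set.mem_Ioi] at hx hy
  linarith

/-- The product `q_a q_{a-1} ⋯ q_{a-n+1}`. -/
def lossProd (a : ZMod (d * J)) (n : ℕ) : ℝ := ∏ m ∈ Finset.range n, M.q (a - (m : ZMod (d * J)))

lemma run_eq (i : ZMod (d * J)) (k : ℕ) :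
    M.run i k = M.lossProd i (k * J) * M.p (i - ((k * J : ℕ) : ZMod (d * J))) := rfl

lemma lossProd_add (a : ZMod (d * J)) (m n : ℕ) :
    M.lossProd a (m + n) = M.lossProd a m * M.lossProd (a - m) n := by
  simp only [lossProd, Finset.prod_range_add, Nat.cast_add, sub_sub]

lemma lossProd_pos (a : ZMod (d * J)) (n : ℕ) : 0 < M.lossProd a n :=
  Finset.prod_pos fun _ _ => M.q_pos _

lemma run_nonneg (i : ZMod (d * J)) (k : ℕ) : 0 ≤ M.run i k :=
  mul_nonneg (M.lossProd_pos _ _).le (M.p_pos _).le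

lemma Q_pos : 0 < M.Q := Finset.prod_pos fun _ _ => M.q_pos _

lemma lossProd_le_pow {r : ℝ} (hr : ∀ i, M.q i ≤ r) (a : ZMod (d * J)) (n : ℕ) :
    M.lossProd a n ≤ r ^ n := by
  refine (Finset.prod_le_prod (fun _ _ => (M.q_pos _).le) (fun _ _ => hr _)).trans ?_
  simp

lemma natCast_mul_self_zmod : ((d * J : ℕ) : ZMod (d * J)) = 0 := ZMod.natCast_self _

variable [NeZero (d * J)]

lemma d_pos_of_neZero (d J : ℕ) [NeZero (d * J)] : 0 < d :=
  Nat.pos_of_ne_zero fun h => NeZero.ne (d * J) (by simp [h])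

lemma J_pos_of_neZero (d J : ℕ) [NeZero (d * J)] : 0 < J :=
  Nat.pos_of_ne_zero fun h => NeZero.ne (d * J) (by simp [h])

lemma prod_range_natCast_zmod (n : ℕ) [NeZero n] (f : ZMod n → ℝ) :
    ∏ m ∈ Finset.range n, f (m : ZMod n) = ∏ x : ZMod n, f x := by
  refine Finset.prod_bij (fun m _ => (m : ZMod n)) (fun _ _ => Finset.mem_univ _) ?_ ?_
    (fun _ _ => rfl)
  · intro a ha b hb hab
    rw [Finset.mem_range] at ha hb
    rw [ZMod.natCast_eq_natCast_iff'] at hab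
    rwa [Nat.mod_eq_of_lt ha, Nat.mod_eq_of_lt hb] at hab
  · intro b _
    exact ⟨b.val, Finset.mem_range.2 (ZMod.val_lt b), ZMod.natCast_zmod_val b⟩

lemma lossProd_period (a : ZMod (d * J)) : M.lossProd a (d * J) = M.Q := by
  rw [lossProd, Q, prod_range_natCast_zmod (d * J) (fun x => M.q (a - x)),
    prod_range_natCast_zmod (d * J) (fun x => M.q x)]
  exact Equiv.prod_comp (Equiv.subLeft a) M.q

lemma lossProd_add_period (a : ZMod (d * J)) (n : ℕ) :
    M.lossProd a (n + d * J) = M.Q * M.lossProd a n := by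
  rw [lossProd_add, lossProd_period, mul_comm]

lemma exists_q_le : ∃ r : ℝ, 0 ≤ r ∧ r < 1 ∧ ∀ i, M.q i ≤ r := by
  obtain ⟨i, -, hi⟩ := Finset.exists_max_image (Finset.univ : Finset (ZMod (d * J))) M.q
    ⟨0, Finset.mem_univ _⟩
  exact ⟨M.q i, (M.q_pos i).le, M.q_lt_one i, fun j => hi j (Finset.mem_univ _)⟩

lemma Q_lt_one : M.Q < 1 := by
  obtain ⟨r, h0, h1, hr⟩ := M.exists_q_le
  rw [← M.lossProd_period 0]
  exact (M.lossProd_le_pow hr _ _).trans_lt (pow_lt_one₀ h0 h1 (NeZero.ne _))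

/-- Lengthening the string by `d * J` losses means one full turn of the cam, which costs a factor
`Q` and returns to the same winning position. All factors `1 / (1 - Q)` originate here. -/
lemma run_add (i : ZMod (d * J)) (k : ℕ) : M.run i (k + d) = M.Q * M.run i k := by
  rw [run_eq, run_eq, add_mul, lossProd_add_period, Nat.cast_add, natCast_mul_self_zmod, add_zero]
  ring

lemma summable_run (i : ZMod (d * J)) : Summable (M.run i) := by
  obtain ⟨r, h0, h1, hr⟩ := M.exists_q_le
  refine Summable.of_nonneg_of_le (M.run_nonneg i) (fun k => ?_)
    (summable_geometric_of_lt_one h0 h1)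
  calc M.run i k ≤ r ^ (k * J) * 1 :=
        mul_le_mul (M.lossProd_le_pow hr _ _) (M.p_le_one _) (M.p_pos _).le (by positivity)
    _ ≤ r ^ k := by
        rw [mul_one]
        exact pow_le_pow_of_le_one h0 h1.le (Nat.le_mul_of_pos_right k (J_pos_of_neZero d J))

/-- The terms beyond the first `d` add up to `Q` times the whole series, so the series equals its
first `d` terms divided by `1 - Q`. -/
lemma hasSum_run (i : ZMod (d * J)) : HasSum (fun k => M.run i (k + 1)) (M.award i) := by
  have hs : Summable fun k => M.run i (k + 1) := (summable_nat_add_iff 1).2 (M.summable_run i)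
  have h := hs.sum_add_tsum_nat_add d
  have h2 : ∑' k, M.run i (k + d + 1) = M.Q * ∑' k, M.run i (k + 1) := by
    rw [← tsum_mul_left]
    exact tsum_congr fun k => by rw [add_right_comm, M.run_add]
  have hQ := M.Q_lt_one
  have : M.award i = ∑' k, M.run i (k + 1) := by
    rw [award, div_eq_iff (by linarith), ← Finset.Ico_add_one_right_eq_Icc, Finset.sum_Ico_eq_sum_range]
    simp only [Nat.add_sub_cancel, add_comm 1]
    rw [h2] at h
    linarith
  rw [this]
  exact hs.hasSum

/-- `∑_{k ≥ x / J} w_i(k)`. -/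
def tail (x : ℤ) (i : ZMod (d * J)) : ℝ :=
  ∑' k : ℕ, if x ≤ ((k * J : ℕ) : ℤ) then M.run i k else 0

lemma summable_tail (x : ℤ) (i : ZMod (d * J)) :
    Summable fun k : ℕ => if x ≤ ((k * J : ℕ) : ℤ) then M.run i k else 0 := by
  refine Summable.of_nonneg_of_le (fun k => ?_) (fun k => ?_) (M.summable_run i)
  · split_ifs
    exacts [M.run_nonneg _ _, le_rfl]
  · split_ifs
    exacts [le_rfl, M.run_nonneg _ _]

/-- Since `x` is positive, no index below `d` passes the shifted threshold; the remaining indices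
are shifted by `d`. -/
lemma tail_add_period {x : ℤ} (hx : 1 ≤ x) (i : ZMod (d * J)) :
    M.tail (x + ((d * J : ℕ) : ℤ)) i = M.Q * M.tail x i := by
  rw [tail, ← (M.summable_tail _ i).sum_add_tsum_nat_add d, Finset.sum_eq_zero, zero_add, tail,
    ← tsum_mul_left]
  · refine tsum_congr fun k => ?_
    rw [M.run_add, mul_ite, mul_zero]
    refine if_congr ?_ rfl rfl
    push_cast
    constructor <;> intro h <;> linarith
  · intro k hk
    rw [if_neg]
    have : k * J ≤ d * J := Nat.mul_le_mul_right _ (Finset.mem_range.1 hk).le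
    have : ((k * J : ℕ) : ℤ) ≤ ((d * J : ℕ) : ℤ) := by exact_mod_cast this
    linarith

lemma hasSum_tail {x : ℤ} (hx : 1 ≤ x) (i : ZMod (d * J)) :
    HasSum (fun k : ℕ => if x ≤ (((k + 1) * J : ℕ) : ℤ) then M.run i (k + 1) else 0)
      (M.tail x i) := by
  have h := (hasSum_nat_add_iff' 1).2 (M.summable_tail x i).hasSum
  have h0 : ¬ x ≤ 0 := by linarith
  simpa [h0, tail] using h

/-- The bound `hxn` ensures that truncation at `n` discards no `k` with `k * J < x`. This converts
the finite sums in the coefficients A, B and C into tails. -/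
lemma sum_run_eq_award_sub_tail (n : ℕ) {x : ℤ} (hx : 1 ≤ x) (hxn : x ≤ (((n + 1) * J : ℕ) : ℤ))
    (i : ZMod (d * J)) :
    ∑ k ∈ Finset.Icc 1 n with (((k * J : ℕ) : ℤ) < x), M.run i k = M.award i - M.tail x i := by
  have h := (M.hasSum_run i).sub (M.hasSum_tail hx i)
  rw [← h.tsum_eq, tsum_eq_sum (s := Finset.range n), Finset.sum_filter,
    ← Finset.Ico_add_one_right_eq_Icc, Finset.sum_Ico_eq_sum_range]
  · refine Finset.sum_congr (by simp) fun k _ => ?_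
    rw [add_comm 1 k]
    by_cases hk : x ≤ (((k + 1) * J : ℕ) : ℤ)
    · rw [if_pos hk, if_neg hk.not_gt, sub_self]
    · rw [if_neg hk, if_pos (not_le.1 hk), sub_zero]
  · intro k hk
    have hk' : n + 1 ≤ k + 1 := by simpa using hk
    have : (((n + 1) * J : ℕ) : ℤ) ≤ (((k + 1) * J : ℕ) : ℤ) := by
      exact_mod_cast Nat.mul_le_mul_right _ hk'
    rw [if_pos (hxn.trans this), sub_self]

end Parameters

/-! ### Pathwise analysis of the pointer: coupling and loss of memory -/

section Pointer

variable {J : ℕ}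

lemma pointer_lt (hJ : 0 < J) {y : ℕ} (hy : y < J) (r : ℕ → ℝ) (n : ℕ) : pointer J y r n < J := by
  induction n with
  | zero => exact hy
  | succ n ih =>
    rw [pointer]
    split_ifs
    · exact hJ
    · omega
    · exact hJ

lemma pointer_add (y : ℕ) (r : ℕ → ℝ) (m n : ℕ) :
    pointer J y r (m + n) = pointer J (pointer J y r m) (fun k => r (m + k)) n := by
  induction n with
  | zero => rfl
  | succ n ih => rw [← add_assoc, pointer, pointer, ih]

lemma payoutStar_add (y : ℕ) (r : ℕ → ℝ) (m n : ℕ) :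
    payoutStar J y r (m + n) = payoutStar J (pointer J y r m) (fun k => r (m + k)) n := by
  rw [payoutStar, payoutStar, pointer_add]

lemma pointer_eq_of_win (y y' : ℕ) {r : ℕ → ℝ} {l n : ℕ} (hl : l < n) (h : r l ≠ 0) :
    pointer J y r n = pointer J y' r n := by
  obtain ⟨m, rfl⟩ := Nat.exists_eq_add_of_lt hl
  rw [add_right_comm, pointer_add, pointer_add y']
  simp [pointer, h]

/-- Two machines fed with the same payouts but started with different pointer positions stay within
`2 J` coins of each other. -/
lemma abs_sum_payoutStar_sub_le (hJ : 0 < J) {y y' : ℕ} (hy : y < J) (hy' : y' < J) (r : ℕ → ℝ)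
    (n : ℕ) :
    |∑ l ∈ Finset.range n, payoutStar J y r l - ∑ l ∈ Finset.range n, payoutStar J y' r l| ≤
      2 * J := by
  have bound : ∀ {a b : ℕ}, a < J → b < J → |(a : ℝ) - b| ≤ J := by
    intro a b ha hb
    have ha' : (a : ℝ) ≤ J := by exact_mod_cast ha.le
    have hb' : (b : ℝ) ≤ J := by exact_mod_cast hb.le
    rw [abs_le]
    constructor <;> linarith [Nat.cast_nonneg (α := ℝ) a, Nat.cast_nonneg (α := ℝ) b]
  -- Until the first win, each loss raises (awards so far) + (pointer) by exactly one on both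
  -- machines, because `J + 0 = (J - 1) + 1`; this gives the first alternative. A win sends both
  -- pointers to `0` and pays no award, after which the difference is frozen: the second
  -- alternative.
  suffices H : (∑ l ∈ Finset.range n, payoutStar J y r l - ∑ l ∈ Finset.range n, payoutStar J y' r l
        = ((y : ℝ) - y') - ((pointer J y r n : ℝ) - pointer J y' r n)) ∨
      (pointer J y r n = pointer J y' r n ∧
        |∑ l ∈ Finset.range n, payoutStar J y r l - ∑ l ∈ Finset.range n, payoutStar J y' r l| ≤
          2 * J) by
    rcases H with H | H
    · rw [H]
      refine (abs_sub _ _).trans ?_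
      linarith [bound hy hy', bound (pointer_lt hJ hy r n) (pointer_lt hJ hy' r n)]
    · exact H.2
  induction n with
  | zero => left; simp [pointer]
  | succ n ih =>
    rw [Finset.sum_range_succ, Finset.sum_range_succ, pointer, pointer, payoutStar, payoutStar]
    have hu := pointer_lt hJ hy r n
    have hv := pointer_lt hJ hy' r n
    by_cases hr : r n = 0
    · rcases ih with ih | ⟨ih, ih'⟩
      · left
        have step : ∀ u : ℕ, u < J → ((if u = J - 1 ∧ r n = 0 then (J : ℝ) else 0) +
            ((if r n = 0 then (if u = J - 1 then 0 else u + 1) else 0 : ℕ) : ℝ)) = u + 1 := by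
          intro u hu
          by_cases h : u = J - 1
          · simp only [h, hr, and_self, if_true, Nat.cast_zero, add_zero]
            rw [Nat.cast_sub hJ]
            simp
          · simp [h, hr]
        linarith [step _ hu, step _ hv]
      · right
        rw [ih]
        refine ⟨rfl, ?_⟩
        rw [add_sub_add_right_eq_sub]
        exact ih'
    · right
      simp only [hr, and_false, if_false, add_zero, add_sub_add_right_eq_sub, true_and]
      rcases ih with ih | ⟨ih, ih'⟩
      · rw [ih]
        refine (abs_sub _ _).trans ?_
        linarith [bound hy hy', bound hu hv]
      · exact ih'

/-- `L` consecutive losses after a win put the pointer into position `L % J`. -/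
lemma pointer_eq_mod (hJ : 0 < J) {r : ℕ → ℝ} (L : ℕ) : ∀ l : ℕ, L ≤ l →
    (L < l → r (l - L - 1) ≠ 0) → (∀ m < L, r (l - m - 1) = 0) → pointer J 0 r l = L % J := by
  induction L with
  | zero =>
    intro l _ h _
    cases l with
    | zero => simp [pointer]
    | succ l =>
      have := h (Nat.succ_pos l)
      simp only [Nat.add_sub_cancel, Nat.sub_zero] at this
      simp [pointer, this]
  | succ L ih =>
    intro l hl h1 h2
    obtain ⟨l, rfl⟩ : ∃ l', l = l' + 1 := ⟨l - 1, by omega⟩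
    have h0 : r l = 0 := by simpa using h2 0 (Nat.succ_pos L)
    have ih' := ih l (by omega) (fun h => by
        have := h1 (by omega)
        rwa [show l + 1 - (L + 1) - 1 = l - L - 1 by omega] at this) (fun m hm => by
        have := h2 (m + 1) (by omega)
        rwa [show l + 1 - (m + 1) - 1 = l - m - 1 by omega] at this)
    rw [pointer, if_pos h0, ih', Nat.add_mod L 1 J]
    by_cases hL : L % J = J - 1
    · rw [if_pos hL, hL]
      -- For `J = 1` the residue `1 % J` is `0` instead of `1`.
      rcases Nat.lt_or_ge 1 J with hJ1 | hJ1
      · rw [Nat.mod_eq_of_lt hJ1, Nat.sub_add_cancel hJ, Nat.mod_self]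
      · obtain rfl : J = 1 := by omega
        simp
    · have hlt := Nat.mod_lt L hJ
      rw [if_neg hL, Nat.mod_eq_of_lt (a := 1) (by omega), Nat.mod_eq_of_lt (a := L % J + 1) (by omega)]

variable {Ω : Type*} {R : ℤ → Ω → ℝ} {ω : Ω}

/-- After a win, the machine with pointer position `0` produces the stationary payouts. -/
lemma biPayoutStar_eq_payoutStar (hJ : 0 < J) (h0 : ∀ n, 0 ≤ R n ω) {a : ℤ} (ha : 0 < R a ω)
    (l : ℕ) :
    biPayoutStar J R (a + 1 + l) ω = payoutStar J 0 (fun k => R (a + 1 + k) ω) l := by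
  classical
  have hex : ∃ L : ℕ, 0 < R (a + l - L) ω := ⟨l, by simpa using ha⟩
  -- `L` is the length of the losing string that ends at coup `a + l`, just before the coup
  -- considered; the win at `a` forces `L ≤ l`.
  obtain ⟨L, hL, hmin⟩ : ∃ L : ℕ, 0 < R (a + l - L) ω ∧ ∀ m < L, R (a + l - m) ω = 0 :=
    ⟨Nat.find hex, Nat.find_spec hex, fun m hm =>
      le_antisymm (not_lt.1 (Nat.find_min hex hm)) (h0 _)⟩
  have hLl : L ≤ l := by
    by_contra! h
    have := hmin l h
    simp only [add_sub_cancel_right] at this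
    linarith
  have hpt := pointer_eq_mod hJ (r := fun k => R (a + 1 + k) ω) L l hLl
    (fun h => by
      have e : a + 1 + ((l - L - 1 : ℕ) : ℤ) = a + l - L := by omega
      simpa only [e] using hL.ne')
    (fun m hm => by
      have e : a + 1 + ((l - m - 1 : ℕ) : ℤ) = a + l - m := by omega
      simpa only [e] using hmin m hm)
  rw [biPayoutStar, payoutStar, hpt]
  congr 1
  rw [Set.indicator_apply]
  refine if_congr ?_ rfl rfl
  rw [awardEvent, Set.mem_ofPred_eq]
  constructor
  · rintro ⟨k, hk, hwin, hloss⟩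
    have hkJ : 0 < k * J := Nat.mul_pos hk hJ
    have hl0 := hloss 0 hkJ
    simp only [Nat.cast_zero, sub_zero] at hl0
    refine ⟨?_, hl0⟩
    -- The string including the present coup has `L + 1` losses. If `k * J` were larger, the win at
    -- `a + l - L` would be among its losses; if smaller, its opening win would be one of the `L`
    -- losses.
    have hEq : L + 1 = k * J := by
      rcases lt_trichotomy (L + 1) (k * J) with h | h | h
      · have := hloss (L + 1) h
        rw [show a + 1 + (l : ℤ) - ((L + 1 : ℕ) : ℤ) = a + l - L by push_cast; ring] at this
        linarith
      · exact h
      · have := hmin (k * J - 1) (by omega)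
        rw [show a + (l : ℤ) - ((k * J - 1 : ℕ) : ℤ) = a + 1 + l - ((k * J : ℕ) : ℤ) by omega] at this
        linarith
    obtain ⟨k, rfl⟩ : ∃ k', k = k' + 1 := ⟨k - 1, by omega⟩
    rw [show L = (J - 1) + J * k by rw [add_mul, mul_comm k] at hEq; omega, Nat.add_mul_mod_self_left,
      Nat.mod_eq_of_lt (by omega)]
  · rintro ⟨hmod, hl0⟩
    have hdiv : (L / J + 1) * J = L + 1 := by
      have := Nat.div_add_mod L J
      rw [hmod] at this
      rw [add_mul, mul_comm (L / J)]
      omega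
    refine ⟨L / J + 1, Nat.le_add_left _ _, ?_, ?_⟩
    · rw [hdiv, show a + 1 + (l : ℤ) - ((L + 1 : ℕ) : ℤ) = a + l - L by push_cast; ring]
      exact hL
    · rw [hdiv]
      intro m hm
      cases m with
      | zero => simpa using hl0
      | succ m =>
        rw [show a + 1 + (l : ℤ) - ((m + 1 : ℕ) : ℤ) = a + l - m by push_cast; ring]
        exact hmin m (by omega)

/-- The stationary machine has a genuine pointer position at time `a`: the one reached from position
`0` just after the win at `b`. -/
lemma exists_biPayoutStar_eq_payoutStar (hJ : 0 < J) (h0 : ∀ n, 0 ≤ R n ω) {a b : ℤ} (hba : b ≤ a)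
    (hb : 0 < R b ω) : ∃ y < J, ∀ l : ℕ,
      biPayoutStar J R (a + 1 + l) ω = payoutStar J y (fun k => R (a + 1 + k) ω) l := by
  obtain ⟨n, rfl⟩ : ∃ n : ℕ, a = b + n := ⟨(a - b).toNat, by omega⟩
  refine ⟨_, pointer_lt hJ hJ (fun k => R (b + 1 + k) ω) n, fun l => ?_⟩
  have h := biPayoutStar_eq_payoutStar hJ h0 hb (n + l)
  rw [payoutStar_add] at h
  have e : ∀ l : ℕ, b + (n : ℤ) + 1 + l = b + 1 + ((n + l : ℕ) : ℤ) := fun l => by push_cast; ring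
  simp only [e]
  exact h

end Pointer

/-! ### Independence of functions of disjoint groups of coups -/

section SigmaAlgebras

variable {Ω ι : Type*}

/-- The σ-algebra generated by the `R n` with `n ∈ S`. -/
@[reducible] def sigmaOn (R : ι → Ω → ℝ) (S : Set ι) : MeasurableSpace Ω :=
  ⨆ n ∈ S, MeasurableSpace.comap (R n) inferInstance

lemma measurable_sigmaOn (R : ι → Ω → ℝ) {S : Set ι} {n : ι} (hn : n ∈ S) :
    Measurable[sigmaOn R S] (R n) :=
  (comap_measurable (R n)).mono
    (le_iSup₂ (f := fun n (_ : n ∈ S) => MeasurableSpace.comap (R n) inferInstance) n hn) le_rfl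

lemma sigmaOn_le [mΩ : MeasurableSpace Ω] {R : ι → Ω → ℝ} (hR : ∀ n, Measurable (R n))
    (S : Set ι) : sigmaOn R S ≤ mΩ :=
  iSup₂_le fun n _ => (hR n).comap_le

lemma sigmaOn_mono (R : ι → Ω → ℝ) {S T : Set ι} (h : S ⊆ T) : sigmaOn R S ≤ sigmaOn R T :=
  biSup_mono h

variable [mΩ : MeasurableSpace Ω] {P : Measure Ω} {R : ι → Ω → ℝ}

lemma indep_sigmaOn (hR : ∀ n, Measurable (R n)) (hi : iIndepFun R P) {S T : Set ι}
    (hST : Disjoint S T) : Indep (sigmaOn R S) (sigmaOn R T) P :=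
  indep_iSup_of_disjoint (fun n => (hR n).comap_le) ((iIndepFun_iff_iIndep _ _ _).1 hi) hST

lemma indepFun_of_measurable_sigmaOn (hR : ∀ n, Measurable (R n)) (hi : iIndepFun R P)
    {S T : Set ι} (hST : Disjoint S T) {f g : Ω → ℝ} (hf : Measurable[sigmaOn R S] f)
    (hg : Measurable[sigmaOn R T] g) : IndepFun f g P :=
  (IndepFun_iff_Indep f g P).2 (indep_of_indep_of_le_left
    (indep_of_indep_of_le_right (indep_sigmaOn hR hi hST) hg.comap_le) hf.comap_le)

lemma setIntegral_of_measurable_sigmaOn (hR : ∀ n, Measurable (R n)) (hi : iIndepFun R P)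
    {S T : Set ι} (hST : Disjoint S T) {f : Ω → ℝ} {A : Set Ω} (hf : Measurable[sigmaOn R S] f)
    (hA : MeasurableSet[sigmaOn R T] A) [IsProbabilityMeasure P] :
    ∫ ω in A, f ω ∂P = (∫ ω, f ω ∂P) * P.real A := by
  rw [mul_comm]
  have hfm : Measurable f := hf.mono (sigmaOn_le hR S) le_rfl
  exact Indep.setIntegral_eq_mul (X := f) (f := fun x => x) (sigmaOn_le hR T)
    (indep_of_indep_of_le_right (indep_sigmaOn hR hi hST.symm) hf.comap_le) hfm.aemeasurable hA
    (by fun_prop)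

lemma measureReal_inter_of_sigmaOn (hR : ∀ n, Measurable (R n)) (hi : iIndepFun R P)
    {S T : Set ι} (hST : Disjoint S T) {A B : Set Ω} (hA : MeasurableSet[sigmaOn R S] A)
    (hB : MeasurableSet[sigmaOn R T] B) :
    P.real (A ∩ B) = P.real A * P.real B := by
  rw [measureReal_def, (Indep_iff _ _ P).1 (indep_sigmaOn hR hi hST) A B hA hB,
    ENNReal.toReal_mul]
  rfl

/-- Functions of disjoint groups of independent variables are independent. -/
lemma iIndepFun_of_measurable_sigmaOn (hR : ∀ n, Measurable (R n)) (hi : iIndepFun R P)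
    {κ : Type*} {S : κ → Set ι} (hS : Pairwise (Function.onFun Disjoint S)) {X : κ → Ω → ℝ}
    (hX : ∀ m, Measurable[sigmaOn R (S m)] (X m)) : iIndepFun X P := by
  classical
  have := hi.isProbabilityMeasure
  rw [iIndepFun_iff_measure_inter_preimage_eq_mul]
  intro s sets hsets
  induction s using Finset.induction_on with
  | empty => simp
  | insert a s ha ih =>
    rw [Finset.set_biInter_insert, Finset.prod_insert ha,
      ← ih fun i hi => hsets i (Finset.mem_insert_of_mem hi)]
    refine (Indep_iff _ _ P).1 (indep_sigmaOn hR hi (T := ⋃ i ∈ s, S i) ?_) _ _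
      (hX a (hsets a (Finset.mem_insert_self _ _))) ?_
    · simp only [Set.disjoint_iUnion_right]
      intro i hi
      exact hS fun h => ha (h ▸ hi)
    · refine Finset.measurableSet_biInter (m := sigmaOn R (⋃ i ∈ s, S i)) s fun i hi => ?_
      exact sigmaOn_mono R (Set.subset_biUnion_of_mem (u := fun i => S i) hi) _
        (hX i (hsets i (Finset.mem_insert_of_mem hi)))

/-- Turns covariances with an award into integrals over the award event, which can be split over
streaks. -/
lemma cov_indicator_one [IsProbabilityMeasure P] {f : Ω → ℝ} (hf : MemLp f 2 P) {A : Set Ω}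
    (hA : MeasurableSet A) :
    cov[f, A.indicator (fun _ => (1 : ℝ)); P] = ∫ ω in A, f ω ∂P - (∫ ω, f ω ∂P) * P.real A := by
  have hA2 : MemLp (A.indicator (fun _ => (1 : ℝ))) 2 P := (memLp_const 1).indicator hA
  rw [covariance_eq_sub hf hA2, integral_indicator_const _ hA, ← integral_indicator hA]
  simp only [smul_eq_mul, mul_one]
  congr 1
  refine integral_congr_ae (ae_of_all _ fun ω => ?_)
  by_cases h : ω ∈ A <;> simp [h]

end SigmaAlgebras

/-! ### Losing strings and award events -/

section Events

variable {Ω : Type*} {J : ℕ} {R : ℤ → Ω → ℝ}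

/-- Coups `n, n-1, …, n-L+1` are losses. -/
def lossEvent (R : ℤ → Ω → ℝ) (n : ℤ) (L : ℕ) : Set Ω := {ω | ∀ m < L, R (n - (m : ℤ)) ω = 0}

/-- Coup `n` completes a string of exactly `k * J` losses. -/
def streak (J : ℕ) (R : ℤ → Ω → ℝ) (n : ℤ) (k : ℕ) : Set Ω :=
  {ω | 0 < R (n - ((k * J : ℕ) : ℤ)) ω} ∩ lossEvent R n (k * J)

lemma awardEvent_eq_iUnion (n : ℤ) : awardEvent J R n = ⋃ k : ℕ, streak J R n (k + 1) := by
  ext ω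
  simp only [awardEvent, Set.mem_ofPred_eq, streak, lossEvent, Set.mem_iUnion, Set.mem_inter_iff]
  constructor
  · rintro ⟨k, hk, h⟩
    obtain ⟨k, rfl⟩ : ∃ k', k = k' + 1 := ⟨k - 1, by omega⟩
    exact ⟨k, h⟩
  · rintro ⟨k, h⟩
    exact ⟨k + 1, Nat.le_add_left _ _, h⟩

/-- The win that opens the shorter string would be one of the losses of the longer one. -/
lemma eq_of_mem_streak (hJ : 0 < J) {n : ℤ} {k l : ℕ} {ω : Ω} (hk : ω ∈ streak J R n k)
    (hl : ω ∈ streak J R n l) : k = l := by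
  by_contra hne
  rcases lt_or_gt_of_ne hne with h | h
  · exact hk.1.ne' (hl.2 _ (Nat.mul_lt_mul_of_pos_right h hJ))
  · exact hl.1.ne' (hk.2 _ (Nat.mul_lt_mul_of_pos_right h hJ))

lemma pairwise_disjoint_streak (hJ : 0 < J) (n : ℤ) :
    Pairwise (Function.onFun Disjoint fun k => streak J R n (k + 1)) := fun _ _ hkl =>
  Set.disjoint_left.2 fun _ hk hl => hkl (Nat.succ_injective (eq_of_mem_streak hJ hk hl))

/-- The σ-algebra is arbitrary and measurability is asked only of the coups involved, so that the
statement can be instantiated at `sigmaOn R` of the relevant window of coups. The following lemmas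
have the same form. -/
lemma measurableSet_lossEvent [MeasurableSpace Ω] {n : ℤ} {L : ℕ}
    (h : ∀ l, n - L < l → l ≤ n → Measurable (R l)) : MeasurableSet (lossEvent R n L) := by
  have : lossEvent R n L = ⋂ m ∈ Finset.range L, R (n - (m : ℤ)) ⁻¹' {0} := by
    ext ω
    simp [lossEvent]
  rw [this]
  refine Finset.measurableSet_biInter _ fun m hm => ?_
  have := Finset.mem_range.1 hm
  exact h _ (by omega) (by omega) (measurableSet_singleton 0)

lemma measurableSet_streak [MeasurableSpace Ω] {n : ℤ} {k : ℕ}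
    (h : ∀ l, n - ((k * J : ℕ) : ℤ) ≤ l → l ≤ n → Measurable (R l)) :
    MeasurableSet (streak J R n k) := by
  refine MeasurableSet.inter ?_ (measurableSet_lossEvent fun l h1 h2 => h l h1.le h2)
  exact measurableSet_lt measurable_const (h _ le_rfl (by omega))

lemma measurableSet_awardEvent [MeasurableSpace Ω] {n : ℤ} (h : ∀ l ≤ n, Measurable (R l)) :
    MeasurableSet (awardEvent J R n) := by
  rw [awardEvent_eq_iUnion]
  exact MeasurableSet.iUnion fun k => measurableSet_streak fun l _ hl => h l hl

/-- The indicator of a Futurity award at coup `n`. -/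
def awardInd (J : ℕ) (R : ℤ → Ω → ℝ) (n : ℤ) : Ω → ℝ :=
  (awardEvent J R n).indicator fun _ => (1 : ℝ)

lemma measurable_awardInd [MeasurableSpace Ω] {n : ℤ} (h : ∀ l ≤ n, Measurable (R l)) :
    Measurable (awardInd J R n) := measurable_const.indicator (measurableSet_awardEvent h)

lemma biPayoutStar_eq (n : ℤ) : biPayoutStar J R n = R n + fun ω => (J : ℝ) * awardInd J R n ω := by
  ext ω
  by_cases h : ω ∈ awardEvent J R n <;> simp [biPayoutStar, awardInd, h]

lemma measurable_biPayoutStar [MeasurableSpace Ω] {n : ℤ} (h : ∀ l ≤ n, Measurable (R l)) :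
    Measurable (biPayoutStar J R n) := by
  rw [biPayoutStar_eq]
  exact (h n le_rfl).add (measurable_const.mul (measurable_awardInd h))

lemma measurableSet_lossEvent_sigmaOn (n : ℤ) (L : ℕ) :
    MeasurableSet[sigmaOn R (Set.Ioc (n - L) n)] (lossEvent R n L) :=
  @measurableSet_lossEvent Ω R (sigmaOn R (Set.Ioc (n - L) n)) n L fun _ h1 h2 =>
    measurable_sigmaOn R ⟨h1, h2⟩

lemma measurableSet_streak_sigmaOn (n : ℤ) (k : ℕ) :
    MeasurableSet[sigmaOn R (Set.Icc (n - ((k * J : ℕ) : ℤ)) n)] (streak J R n k) :=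
  @measurableSet_streak Ω J R (sigmaOn R (Set.Icc (n - ((k * J : ℕ) : ℤ)) n)) n k fun _ h1 h2 =>
    measurable_sigmaOn R ⟨h1, h2⟩

lemma measurable_awardInd_sigmaOn (n : ℤ) :
    Measurable[sigmaOn R (Set.Iic n)] (awardInd J R n) :=
  @measurable_awardInd Ω J R (sigmaOn R (Set.Iic n)) n fun _ hl => measurable_sigmaOn R hl

lemma measurable_biPayoutStar_sigmaOn (n : ℤ) :
    Measurable[sigmaOn R (Set.Iic n)] (biPayoutStar J R n) :=
  @measurable_biPayoutStar Ω J R (sigmaOn R (Set.Iic n)) n fun _ hl => measurable_sigmaOn R hl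

end Events

/-! ### First moments and streak-by-streak integration -/

section Moments

variable {d J : ℕ} {M : FuturityMachine d J} {Ω : Type*} [mΩ : MeasurableSpace Ω] {P : Measure Ω}
  {R : ℤ → Ω → ℝ}

namespace IsBiinfinitePayouts

lemma memLp (h : M.IsBiinfinitePayouts P R) (n : ℤ) : MemLp (R n) 2 P := by
  have := M.memLp_two_law ((n - 1 : ℤ) : ZMod (d * J))
  rw [← h.map_eq, memLp_map_measure_iff (by fun_prop) (h.measurable n).aemeasurable] at this
  exact this

lemma integral_eq (h : M.IsBiinfinitePayouts P R) (n : ℤ) :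
    ∫ ω, R n ω ∂P = M.mean ((n - 1 : ℤ) : ZMod (d * J)) := by
  rw [mean, ← h.map_eq, integral_map (h.measurable n).aemeasurable (by fun_prop)]

lemma variance_eq (h : M.IsBiinfinitePayouts P R) (n : ℤ) :
    Var[R n; P] = M.var ((n - 1 : ℤ) : ZMod (d * J)) := by
  rw [var, ← h.map_eq, variance_map (by fun_prop) (h.measurable n).aemeasurable]
  rfl

lemma ae_nonneg (h : M.IsBiinfinitePayouts P R) : ∀ᵐ ω ∂P, ∀ n, 0 ≤ R n ω := by
  rw [ae_all_iff]
  intro n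
  have := M.payout_nonneg ((n - 1 : ℤ) : ZMod (d * J))
  rw [← h.map_eq, ae_map_iff (h.measurable n).aemeasurable measurableSet_Ici] at this
  exact this

lemma measureReal_pos (h : M.IsBiinfinitePayouts P R) (n : ℤ) :
    P.real {ω | 0 < R n ω} = M.p ((n - 1 : ℤ) : ZMod (d * J)) := by
  rw [p, ← h.map_eq, map_measureReal_apply (h.measurable n) measurableSet_Ioi]
  rfl

lemma measureReal_eq_zero (h : M.IsBiinfinitePayouts P R) (n : ℤ) :
    P.real (R n ⁻¹' {0}) = M.q ((n - 1 : ℤ) : ZMod (d * J)) := by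
  rw [← law_real_singleton_zero, ← h.map_eq,
    map_measureReal_apply (h.measurable n) (measurableSet_singleton 0)]

lemma measureReal_lossEvent (h : M.IsBiinfinitePayouts P R) (n : ℤ) (L : ℕ) :
    P.real (lossEvent R n L) = M.lossProd ((n - 1 : ℤ) : ZMod (d * J)) L := by
  have e : lossEvent R n L = ⋂ m ∈ Finset.range L, R (n - (m : ℤ)) ⁻¹' {0} := by
    ext ω
    simp [lossEvent]
  have hi : iIndepFun (fun m : ℕ => R (n - (m : ℤ))) P :=
    h.indep.precomp (g := fun m : ℕ => n - (m : ℤ)) fun a b hab => by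
      simpa using hab
  rw [e, measureReal_def, hi.measure_inter_preimage_eq_mul _ (sets := fun _ => {0})
    (fun _ _ => measurableSet_singleton 0), ENNReal.toReal_prod, lossProd]
  refine Finset.prod_congr rfl fun m _ => ?_
  rw [← measureReal_def, h.measureReal_eq_zero]
  congr 1
  push_cast
  ring

lemma measurableSet_award (h : M.IsBiinfinitePayouts P R) (n : ℤ) :
    MeasurableSet (awardEvent J R n) := measurableSet_awardEvent fun l _ => h.measurable l

lemma measureReal_streak (h : M.IsBiinfinitePayouts P R) (n : ℤ) (k : ℕ) :
    P.real (streak J R n k) = M.run ((n - 1 : ℤ) : ZMod (d * J)) k := by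
  rw [streak, measureReal_inter_of_sigmaOn (S := {n - ((k * J : ℕ) : ℤ)})
    (T := Set.Ioc (n - ((k * J : ℕ) : ℤ)) n) h.measurable h.indep (by simp),
    h.measureReal_pos, h.measureReal_lossEvent, run_eq, mul_comm]
  · congr 2
    push_cast
    ring
  · exact measurable_sigmaOn R (Set.mem_singleton _) measurableSet_Ioi
  · exact measurableSet_lossEvent_sigmaOn n (k * J)

lemma hasSum_setIntegral_streak [NeZero (d * J)] (h : M.IsBiinfinitePayouts P R) (n : ℤ) {f : Ω → ℝ}
    (hf : Integrable f P) :
    HasSum (fun k => ∫ ω in streak J R n (k + 1), f ω ∂P) (∫ ω in awardEvent J R n, f ω ∂P) := by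
  rw [awardEvent_eq_iUnion]
  exact hasSum_integral_iUnion (fun k => measurableSet_streak fun l _ _ => h.measurable l)
    (pairwise_disjoint_streak (J_pos_of_neZero d J) n) hf.integrableOn

variable [IsProbabilityMeasure P]

lemma memLp_awardInd (h : M.IsBiinfinitePayouts P R) (n : ℤ) : MemLp (awardInd J R n) 2 P :=
  (memLp_const 1).indicator (h.measurableSet_award n)

lemma memLp_biPayoutStar (h : M.IsBiinfinitePayouts P R) (n : ℤ) :
    MemLp (biPayoutStar J R n) 2 P := by
  rw [biPayoutStar_eq]
  exact (h.memLp n).add ((h.memLp_awardInd n).const_mul _)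

/-- The whole string, its opening win included, lies after coup `i`, hence is independent of `f`. -/
lemma setIntegral_streak_of_lt (h : M.IsBiinfinitePayouts P R) {i n : ℤ} {k : ℕ} {f : Ω → ℝ}
    (hf : Measurable[sigmaOn R (Set.Iic i)] f) (hk : i < n - ((k * J : ℕ) : ℤ)) :
    ∫ ω in streak J R n k, f ω ∂P =
      (∫ ω, f ω ∂P) * M.run ((n - 1 : ℤ) : ZMod (d * J)) k := by
  rw [← h.measureReal_streak]
  refine setIntegral_of_measurable_sigmaOn h.measurable h.indep ?_ hf
    (measurableSet_streak_sigmaOn n k)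
  exact Set.disjoint_left.2 fun x hx hx' => by
    simp only [Set.mem_Iic, Set.mem_Icc] at hx hx'
    linarith [hx'.1]

/-- The condition that the opening coup is a win may be dropped, since its payout vanishes
otherwise. What remains is independent of the later losses, which is why a loss product and not
`run` appears. -/
lemma setIntegral_streak_start (h : M.IsBiinfinitePayouts P R) (n : ℤ) (k : ℕ) :
    ∫ ω in streak J R n k, R (n - ((k * J : ℕ) : ℤ)) ω ∂P =
      M.mean ((n - ((k * J : ℕ) : ℤ) - 1 : ℤ) : ZMod (d * J)) *
        M.lossProd ((n - 1 : ℤ) : ZMod (d * J)) (k * J) := by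
  rw [← h.integral_eq, ← h.measureReal_lossEvent]
  have hL : MeasurableSet (lossEvent R n (k * J)) :=
    measurableSet_lossEvent fun l _ _ => h.measurable l
  rw [← setIntegral_of_measurable_sigmaOn (S := {n - ((k * J : ℕ) : ℤ)})
    (T := Set.Ioc (n - ((k * J : ℕ) : ℤ)) n) h.measurable h.indep (by simp)
    (measurable_sigmaOn R rfl) (measurableSet_lossEvent_sigmaOn n (k * J))]
  refine (setIntegral_eq_of_subset_of_ae_sdiff_eq_zero hL.nullMeasurableSet
    Set.inter_subset_right ?_).symm
  filter_upwards [h.ae_nonneg] with ω h0 hω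
  refine le_antisymm (not_lt.1 fun hlt => hω.2 ⟨hlt, hω.1⟩) (h0 _)

variable [NeZero (d * J)]

lemma measureReal_awardEvent (h : M.IsBiinfinitePayouts P R) (n : ℤ) :
    P.real (awardEvent J R n) = M.award ((n - 1 : ℤ) : ZMod (d * J)) := by
  have h1 := h.hasSum_setIntegral_streak n (integrable_const 1)
  simp only [setIntegral_const, smul_eq_mul, mul_one, h.measureReal_streak] at h1
  exact h1.unique (M.hasSum_run _)

lemma integral_awardInd (h : M.IsBiinfinitePayouts P R) (n : ℤ) :
    ∫ ω, awardInd J R n ω ∂P = M.award ((n - 1 : ℤ) : ZMod (d * J)) := by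
  rw [awardInd, integral_indicator_const _ (h.measurableSet_award n), h.measureReal_awardEvent]
  simp

lemma integral_biPayoutStar (h : M.IsBiinfinitePayouts P R) (n : ℤ) :
    ∫ ω, biPayoutStar J R n ω ∂P = M.mean ((n - 1 : ℤ) : ZMod (d * J)) +
      J * M.award ((n - 1 : ℤ) : ZMod (d * J)) := by
  rw [biPayoutStar_eq, integral_add' ((h.memLp n).integrable one_le_two)
    (((h.memLp_awardInd n).integrable one_le_two).const_mul _), integral_const_mul,
    h.integral_eq, h.integral_awardInd]

/-- Distributing the product of expectations over the streaks makes the term of every streak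
independent of `f` vanish. -/
lemma hasSum_cov_awardInd (h : M.IsBiinfinitePayouts P R) (n : ℤ) {f : Ω → ℝ} (hf : MemLp f 2 P) :
    HasSum (fun k => ∫ ω in streak J R n (k + 1), f ω ∂P -
        (∫ ω, f ω ∂P) * M.run ((n - 1 : ℤ) : ZMod (d * J)) (k + 1))
      cov[f, awardInd J R n; P] := by
  rw [awardInd, cov_indicator_one hf (h.measurableSet_award n), h.measureReal_awardEvent]
  exact (h.hasSum_setIntegral_streak n (hf.integrable one_le_two)).sub
    ((M.hasSum_run _).mul_left _)

end IsBiinfinitePayouts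

end Moments

/-! ### Covariances of the stationary payouts of two coups -/

section Covariances

section Events

variable {Ω : Type*} {J : ℕ} {R : ℤ → Ω → ℝ} {ω : Ω}

/-- Coup `i` lies inside the string, so the losing string ending at `i` goes back to the same
opening win and has length `k * J - n`. -/
lemma mem_streak_iff_of_mem_streak {i : ℤ} {n k l : ℕ} (hω : ω ∈ streak J R (i + n) k)
    (hn : n < k * J) : ω ∈ streak J R i l ↔ n + l * J = k * J := by
  constructor
  · intro hl
    rcases lt_trichotomy (n + l * J) (k * J) with h | h | h
    · have := hω.2 (n + l * J) h
      rw [show i + (n : ℤ) - ((n + l * J : ℕ) : ℤ) = i - ((l * J : ℕ) : ℤ) by push_cast; ring] at this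
      exact absurd this hl.1.ne'
    · exact h
    · have := hl.2 (k * J - n) (by omega)
      rw [show i - ((k * J - n : ℕ) : ℤ) = i + n - ((k * J : ℕ) : ℤ) by omega] at this
      exact absurd this hω.1.ne'
  · intro hEq
    constructor
    · change 0 < R (i - ((l * J : ℕ) : ℤ)) ω
      rw [show i - ((l * J : ℕ) : ℤ) = i + n - ((k * J : ℕ) : ℤ) by omega]
      exact hω.1
    · intro m hm
      have := hω.2 (n + m) (by omega)
      rwa [show i + (n : ℤ) - ((n + m : ℕ) : ℤ) = i - m by push_cast; ring] at this

lemma mem_awardEvent_iff_of_mem_streak {i : ℤ} {n k : ℕ} (hω : ω ∈ streak J R (i + n) k)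
    (hn : n < k * J) : ω ∈ awardEvent J R i ↔ J ∣ n := by
  rw [awardEvent_eq_iUnion, Set.mem_iUnion]
  simp_rw [mem_streak_iff_of_mem_streak hω hn]
  constructor
  · rintro ⟨l, hl⟩
    exact (Nat.dvd_add_left (Dvd.intro_left (l + 1) rfl)).1 (hl ▸ Dvd.intro_left k rfl)
  · rintro ⟨c, rfl⟩
    have hck : c < k := by
      rw [mul_comm] at hn
      exact lt_of_mul_lt_mul_right hn (Nat.zero_le _)
    obtain ⟨l, rfl⟩ := Nat.exists_eq_add_of_lt hck
    exact ⟨l, by ring⟩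

/-- Accounts for the single streak, if any, whose opening win is the earlier of the two coups. -/
lemma hasSum_ite_mul_eq (hJ : 0 < J) {n : ℕ} (hn : 0 < n) (c : ℝ) :
    HasSum (fun k : ℕ => if (k + 1) * J = n then c else 0) (if J ∣ n then c else 0) := by
  split_ifs with h
  · obtain ⟨m, rfl⟩ := h
    obtain ⟨m, rfl⟩ : ∃ m', m = m' + 1 := ⟨m - 1, by
      have := Nat.pos_of_mul_pos_left hn
      omega⟩
    convert hasSum_ite_eq m c using 3 with k
    rw [mul_comm J]
    constructor
    · intro h
      have := Nat.eq_of_mul_eq_mul_right hJ h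
      omega
    · rintro rfl
      rfl
  · convert hasSum_zero using 2 with k
    rw [if_neg]
    rintro rfl
    exact h (Dvd.intro_left _ rfl)

end Events

variable {d J : ℕ} (M : FuturityMachine d J)

/-- The covariance of the stationary payouts of two coups which are `n ≥ 1` apart, the first of them
played in cam position `a`. -/
def lagCov (a : ZMod (d * J)) (n : ℕ) : ℝ :=
  J * (M.mean a * (-M.tail n (a + n) + if J ∣ n then M.lossProd (a + n) n else 0)) +
    J ^ 2 * (-(M.award a * M.tail n (a + n)) + if J ∣ n then M.tail (n + 1) (a + n) else 0)

/-- A further turn of the cam keeps the positions and the residue of the lag modulo `J`, and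
multiplies both tails and the loss product by `Q`. -/
lemma lagCov_add_period [NeZero (d * J)] (a : ZMod (d * J)) {n : ℕ} (hn : 0 < n) :
    M.lagCov a (n + d * J) = M.Q * M.lagCov a n := by
  have hd : J ∣ n + d * J ↔ J ∣ n := Nat.dvd_add_left (Dvd.intro_left d rfl)
  rw [lagCov, lagCov, Nat.cast_add (R := ZMod (d * J)), natCast_mul_self_zmod, add_zero, lossProd_add_period,
    Nat.cast_add (R := ℤ), tail_add_period _ (by omega),
    show (n : ℤ) + ((d * J : ℕ) : ℤ) + 1 = (n : ℤ) + 1 + ((d * J : ℕ) : ℤ) by ring,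
    tail_add_period _ (by omega)]
  simp only [hd]
  split_ifs <;> ring

variable {M} {Ω : Type*} [mΩ : MeasurableSpace Ω] {P : Measure Ω} {R : ℤ → Ω → ℝ}

namespace IsBiinfinitePayouts

/-- Stationarity: moving by whole blocks leaves all cam positions unchanged. -/
lemma shift (h : M.IsBiinfinitePayouts P R) (m : ℤ) :
    M.IsBiinfinitePayouts P (fun n => R (m * ((d * J : ℕ) : ℤ) + n)) where
  measurable n := h.measurable _
  indep := h.indep.precomp (g := fun n => m * ((d * J : ℕ) : ℤ) + n) (add_right_injective _)
  map_eq n := by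
    rw [h.map_eq, add_sub_assoc, Int.cast_add, Int.cast_mul, Int.cast_natCast,
      natCast_mul_self_zmod, mul_zero, zero_add]

variable [IsProbabilityMeasure P] [NeZero (d * J)]

lemma cov_payout_awardInd (h : M.IsBiinfinitePayouts P R) (i : ℤ) {n : ℕ} (hn : 0 < n) :
    cov[R i, awardInd J R (i + n); P] = M.mean ((i - 1 : ℤ) : ZMod (d * J)) *
      (-M.tail n ((i + n - 1 : ℤ) : ZMod (d * J)) +
        if J ∣ n then M.lossProd ((i + n - 1 : ℤ) : ZMod (d * J)) n else 0) := by
  refine (h.hasSum_cov_awardInd (i + n) (h.memLp i)).unique ?_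
  have hs := ((M.hasSum_tail (x := n) (by omega) ((i + n - 1 : ℤ) : ZMod (d * J))).neg.add
    (hasSum_ite_mul_eq (J_pos_of_neZero d J) hn
      (M.lossProd ((i + n - 1 : ℤ) : ZMod (d * J)) n))).mul_left
      (M.mean ((i - 1 : ℤ) : ZMod (d * J)))
  refine hs.congr_fun fun k => ?_
  rw [h.integral_eq]
  -- Shorter streaks begin after coup `i` and cancel by independence; for equality coup `i` is the
  -- opening win; longer streaks contain coup `i` as a loss, so the integral is zero.
  rcases lt_trichotomy ((k + 1) * J) n with hk | hk | hk
  · rw [h.setIntegral_streak_of_lt (i := i) (measurable_sigmaOn R Set.self_mem_Iic) (by omega),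
      h.integral_eq, if_neg (by omega), if_neg hk.ne]
    ring
  · have := h.setIntegral_streak_start (i + n) (k + 1)
    rw [hk, add_sub_cancel_right] at this
    rw [this, if_pos (by omega), if_pos hk]
    ring
  · rw [setIntegral_eq_zero_of_forall_eq_zero, if_pos (by omega), if_neg hk.ne']
    · ring
    · intro ω hω
      simpa using hω.2 n hk

lemma cov_awardInd_awardInd (h : M.IsBiinfinitePayouts P R) (i : ℤ) {n : ℕ} (hn : 0 < n) :
    cov[awardInd J R i, awardInd J R (i + n); P] =
      -(M.award ((i - 1 : ℤ) : ZMod (d * J)) * M.tail n ((i + n - 1 : ℤ) : ZMod (d * J))) +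
        if J ∣ n then M.tail (n + 1) ((i + n - 1 : ℤ) : ZMod (d * J)) else 0 := by
  refine (h.hasSum_cov_awardInd (i + n) (h.memLp_awardInd i)).unique ?_
  have hs := ((M.hasSum_tail (x := n) (by omega) ((i + n - 1 : ℤ) : ZMod (d * J))).mul_left
    (M.award ((i - 1 : ℤ) : ZMod (d * J)))).neg.add
    ((M.hasSum_tail (x := n + 1) (by omega) ((i + n - 1 : ℤ) : ZMod (d * J))).mul_left
      (if J ∣ n then 1 else 0))
  rw [ite_mul, one_mul, zero_mul] at hs
  refine hs.congr_fun fun k => ?_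
  rw [h.integral_awardInd]
  have hc : ∀ m : ℕ, ((n : ℤ) ≤ (m : ℤ) ↔ n ≤ m) ∧ ((n : ℤ) + 1 ≤ (m : ℤ) ↔ n < m) := by omega
  simp only [(hc _).1, (hc _).2]
  -- Again the shorter streaks cancel. For equality coup `i` is a win and pays no award. On longer
  -- streaks the award at `i` is deterministic: it is paid exactly when `J ∣ n`. The strict
  -- inequality is the reason for `n + 1` in the second tail.
  rcases lt_trichotomy ((k + 1) * J) n with hk | hk | hk
  · rw [h.setIntegral_streak_of_lt (i := i) (measurable_awardInd_sigmaOn i) (by omega),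
      h.integral_awardInd, if_neg hk.not_ge, if_neg hk.not_gt]
    ring
  · rw [setIntegral_eq_zero_of_forall_eq_zero, if_pos hk.ge, if_neg hk.not_gt]
    · ring
    · intro ω hω
      have h0 : 0 < R i ω := by
        have := hω.1
        rwa [Set.mem_ofPred_eq, hk, add_sub_cancel_right] at this
      rw [awardInd, Set.indicator_of_notMem]
      rw [awardEvent_eq_iUnion, Set.mem_iUnion]
      rintro ⟨l, hl⟩
      have := hl.2 0 (Nat.mul_pos (Nat.succ_pos l) (J_pos_of_neZero d J))
      rw [Nat.cast_zero, sub_zero] at this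
      exact h0.ne' this
  · rw [setIntegral_congr_fun (g := fun _ => if J ∣ n then (1 : ℝ) else 0)
      (measurableSet_streak fun l _ _ => h.measurable l), setIntegral_const,
      h.measureReal_streak, if_pos hk.le, if_pos hk, smul_eq_mul]
    · ring
    · intro ω hω
      by_cases hJn : J ∣ n
      · simp [awardInd, hJn, (mem_awardEvent_iff_of_mem_streak hω hk).2 hJn]
      · have : ω ∉ awardEvent J R i := fun h => hJn ((mem_awardEvent_iff_of_mem_streak hω hk).1 h)
        simp [awardInd, hJn, this]

lemma cov_biPayoutStar (h : M.IsBiinfinitePayouts P R) (i : ℤ) {n : ℕ} (hn : 0 < n) :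
    cov[biPayoutStar J R i, biPayoutStar J R (i + n); P] =
      M.lagCov ((i - 1 : ℤ) : ZMod (d * J)) n := by
  -- The plain payout of the later coup is independent of everything up to coup `i`, so only its
  -- award contributes.
  have hind : cov[biPayoutStar J R i, R (i + n); P] = 0 :=
    (indepFun_of_measurable_sigmaOn (S := Set.Iic i) (T := {i + (n : ℤ)}) h.measurable h.indep
      (by simp [hn.ne']) (measurable_biPayoutStar_sigmaOn i)
      (measurable_sigmaOn R rfl)).covariance_eq_zero (h.memLp_biPayoutStar i) (h.memLp _)
  rw [biPayoutStar_eq (i + n), covariance_add_right (h.memLp_biPayoutStar i) (h.memLp _)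
    ((h.memLp_awardInd _).const_mul _), hind, covariance_const_mul_right, biPayoutStar_eq i,
    covariance_add_left (h.memLp i) ((h.memLp_awardInd i).const_mul _) (h.memLp_awardInd _),
    covariance_const_mul_left, h.cov_payout_awardInd i hn, h.cov_awardInd_awardInd i hn, lagCov]
  have e : ((i + n - 1 : ℤ) : ZMod (d * J)) = ((i - 1 : ℤ) : ZMod (d * J)) + n := by
    push_cast
    ring
  rw [e]
  ring

/-- An award is paid only on a loss, so payout times award indicator is zero and their covariance is
minus the product of the means. -/
lemma variance_biPayoutStar (h : M.IsBiinfinitePayouts P R) (i : ℤ) :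
    Var[biPayoutStar J R i; P] = M.var ((i - 1 : ℤ) : ZMod (d * J)) -
      2 * J * M.mean ((i - 1 : ℤ) : ZMod (d * J)) * M.award ((i - 1 : ℤ) : ZMod (d * J)) +
      J ^ 2 * M.award ((i - 1 : ℤ) : ZMod (d * J)) *
        (1 - M.award ((i - 1 : ℤ) : ZMod (d * J))) := by
  have h0 : ∀ ω, ω ∈ awardEvent J R i → R i ω = 0 := by
    intro ω hω
    rw [awardEvent_eq_iUnion, Set.mem_iUnion] at hω
    obtain ⟨l, hl⟩ := hω
    simpa using hl.2 0 (Nat.mul_pos (Nat.succ_pos l) (J_pos_of_neZero d J))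
  have hA := h.measurableSet_award i
  have h1 : cov[R i, awardInd J R i; P] = -(M.mean ((i - 1 : ℤ) : ZMod (d * J)) *
      M.award ((i - 1 : ℤ) : ZMod (d * J))) := by
    rw [awardInd, cov_indicator_one (h.memLp i) hA, setIntegral_eq_zero_of_forall_eq_zero h0,
      h.integral_eq, h.measureReal_awardEvent, zero_sub]
  have h2 : cov[awardInd J R i, awardInd J R i; P] = M.award ((i - 1 : ℤ) : ZMod (d * J)) *
      (1 - M.award ((i - 1 : ℤ) : ZMod (d * J))) := by
    refine (cov_indicator_one (h.memLp_awardInd i) hA).trans ?_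
    rw [h.integral_awardInd, h.measureReal_awardEvent, awardInd, setIntegral_indicator hA,
      Set.inter_self, setIntegral_const, h.measureReal_awardEvent, smul_eq_mul]
    ring
  rw [← covariance_self (h.memLp_biPayoutStar i).aemeasurable, biPayoutStar_eq i,
    covariance_add_left (h.memLp i) ((h.memLp_awardInd i).const_mul _)
      ((h.memLp i).add ((h.memLp_awardInd i).const_mul _)),
    covariance_add_right (h.memLp i) (h.memLp i) ((h.memLp_awardInd i).const_mul _),
    covariance_add_right ((h.memLp_awardInd i).const_mul _) (h.memLp i)
      ((h.memLp_awardInd i).const_mul _)]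
  simp only [covariance_const_mul_left, covariance_const_mul_right]
  rw [covariance_comm (awardInd J R i) (R i), h1, h2, covariance_self (h.memLp i).aemeasurable,
    h.variance_eq]
  ring

end IsBiinfinitePayouts

end Covariances

/-! ### Symmetric double sums -/

section Sums

lemma sum_sum_range_of_symm (g : ℕ → ℕ → ℝ) (hg : ∀ i j, g i j = g j i) (n : ℕ) :
    ∑ i ∈ Finset.range n, ∑ j ∈ Finset.range n, g i j =
      ∑ i ∈ Finset.range n, g i i +
        2 * ∑ j ∈ Finset.range n, ∑ i ∈ Finset.range j, g i j := by
  induction n with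
  | zero => simp
  | succ n ih =>
    simp only [Finset.sum_range_succ, Finset.sum_add_distrib, ih]
    rw [Finset.sum_congr rfl fun i _ => hg n i]
    ring

lemma sum_Icc_one_eq_sum_range (f : ℕ → ℝ) (n : ℕ) :
    ∑ i ∈ Finset.Icc 1 n, f i = ∑ i ∈ Finset.range n, f (i + 1) := by
  rw [← Finset.Ico_add_one_right_eq_Icc, Finset.sum_Ico_eq_sum_range, Nat.add_sub_cancel]
  simp only [add_comm 1]

lemma sum_sum_Icc_of_symm (g : ℕ → ℕ → ℝ) (hg : ∀ i j, g i j = g j i) (n : ℕ) :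
    ∑ i ∈ Finset.Icc 1 n, ∑ j ∈ Finset.Icc 1 n, g i j =
      ∑ i ∈ Finset.Icc 1 n, g i i +
        2 * ∑ j ∈ Finset.Icc 1 n, ∑ i ∈ Finset.Ico 1 j, g i j := by
  simp only [sum_Icc_one_eq_sum_range, Finset.sum_Ico_eq_sum_range, Nat.add_sub_cancel, add_comm 1]
  exact sum_sum_range_of_symm (fun i j => g (i + 1) (j + 1)) (fun _ _ => hg _ _) n

end Sums

/-! ### Identification of the explicit coefficients with lag covariances -/

section Coefficients

variable {d J : ℕ} (M : FuturityMachine d J)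

lemma lossProd_eq_prod_Ico (i n : ℕ) :
    M.lossProd (((i + n : ℕ) : ZMod (d * J)) - 1) n =
      ∏ m ∈ Finset.Ico i (i + n), M.q (m : ZMod (d * J)) := by
  rw [Finset.prod_Ico_eq_prod_range, Nat.add_sub_cancel_left, ← Finset.prod_range_reflect, lossProd]
  refine Finset.prod_congr rfl fun m hm => ?_
  have := Finset.mem_range.1 hm
  congr 1
  rw [Nat.cast_add, Nat.cast_add, Nat.sub_sub, Nat.cast_sub (by omega)]
  push_cast
  ring

variable [NeZero (d * J)]

/-- Once the sum over `k` is written as award minus tail, the subtracted award terms cancel. -/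
lemma coeffA_eq_lagCov {i j : ℕ} (hij : i < j) (hj : j ≤ d * J) :
    M.coeffA i j = M.lagCov ((i : ZMod (d * J)) - 1) (j - i) := by
  obtain ⟨n, rfl⟩ := Nat.exists_eq_add_of_lt hij
  rw [show i + n + 1 = i + (n + 1) by ring] at *
  set N := n + 1 with hN
  have hsum : ∑ k ∈ Finset.Icc 1 d with k * J + i < i + N,
      M.run (((i + N : ℕ) : ZMod (d * J)) - 1) k =
      M.award (((i + N : ℕ) : ZMod (d * J)) - 1) - M.tail N (((i + N : ℕ) : ZMod (d * J)) - 1) := by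
    rw [← M.sum_run_eq_award_sub_tail d (x := N) (by omega)
      (by rw [Nat.cast_le]; have : d * J ≤ (d + 1) * J := Nat.mul_le_mul_right _ (Nat.le_succ d); omega)]
    refine Finset.sum_congr (Finset.filter_congr fun k _ => ?_) fun _ _ => rfl
    omega
  have hdelta : delta J i (i + N) = if J ∣ N then 1 else 0 := by
    rw [delta]
    refine if_congr ?_ rfl rfl
    rw [Nat.modEq_iff_dvd' (Nat.le_add_right _ _), Nat.add_sub_cancel_left]
  have htail : (∑' k : ℕ, if i + N < k * J + i then M.run (((i + N : ℕ) : ZMod (d * J)) - 1) k else 0)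
      = M.tail (N + 1) (((i + N : ℕ) : ZMod (d * J)) - 1) := by
    refine tsum_congr fun k => if_congr ?_ rfl rfl
    omega
  have hcam : (i : ZMod (d * J)) - 1 + (N : ℕ) = ((i + N : ℕ) : ZMod (d * J)) - 1 := by
    push_cast
    ring
  rw [coeffA, lagCov, hsum, hdelta, htail, Nat.add_sub_cancel_left, hcam, lossProd_eq_prod_Ico]
  split_ifs <;> ring

/-- The lag is that from coup `i` of one block to coup `j` of the next; adding `d * J` does not
affect congruence modulo `J`. -/
lemma coeffBC_eq_lagCov {i j : ℕ} (hi : 1 ≤ i) (hi' : i ≤ d * J) (hj : 1 ≤ j) (hj' : j ≤ d * J) :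
    J * (M.coeffB i j + J * M.coeffC i j) =
      M.lagCov ((i : ZMod (d * J)) - 1) (d * J + j - i) := by
  obtain ⟨N, hN⟩ := Nat.exists_eq_add_of_le (show i ≤ d * J + j by omega)
  have hcam : (i : ZMod (d * J)) - 1 + (N : ℕ) = (j : ZMod (d * J)) - 1 := by
    have : ((d * J + j : ℕ) : ZMod (d * J)) = ((i + N : ℕ) : ZMod (d * J)) := by rw [hN]
    rw [Nat.cast_add, natCast_mul_self_zmod, zero_add] at this
    rw [this]
    push_cast
    ring
  have hsum : ∑ k ∈ Finset.Icc 1 (2 * d) with k * J + i < d * J + j,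
      M.run ((j : ZMod (d * J)) - 1) k =
      M.award ((j : ZMod (d * J)) - 1) - M.tail N ((j : ZMod (d * J)) - 1) := by
    -- The lag is less than `2 * d * J`, so indices up to `2 * d` suffice.
    rw [← M.sum_run_eq_award_sub_tail (2 * d) (x := N) (by omega)
      (by
        rw [Nat.cast_le]
        have : (2 * d + 1) * J = d * J + d * J + J := by ring
        omega)]
    refine Finset.sum_congr (Finset.filter_congr fun k _ => ?_) fun _ _ => rfl
    omega
  have hdelta : delta J i j = if J ∣ N then 1 else 0 := by
    rw [delta]
    refine if_congr ?_ rfl rfl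
    rw [← Nat.add_sub_cancel_left (n := i) (m := N), ← hN,
      ← Nat.modEq_iff_dvd' (show i ≤ d * J + j by omega)]
    have : d * J + j ≡ j [MOD J] := by simp [Nat.ModEq]
    exact ⟨fun h => h.trans this.symm, fun h => h.trans this⟩
  have htail : (∑' k : ℕ, if d * J + j < k * J + i then M.run ((j : ZMod (d * J)) - 1) k else 0)
      = M.tail (N + 1) ((j : ZMod (d * J)) - 1) := by
    refine tsum_congr fun k => if_congr ?_ rfl rfl
    omega
  have hprod : M.lossProd ((j : ZMod (d * J)) - 1) N =
      (∏ m ∈ Finset.Ico i (d * J), M.q (m : ZMod (d * J))) *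
        ∏ m ∈ Finset.range j, M.q (m : ZMod (d * J)) := by
    -- The product wraps around the cam once: it is split at position `d * J`, and the second part
    -- is reduced modulo `d * J`.
    have := M.lossProd_eq_prod_Ico i N
    rw [← hN, ← Finset.prod_Ico_consecutive _ hi' (Nat.le_add_right _ _), Nat.cast_add,
      natCast_mul_self_zmod, zero_add] at this
    rw [this, Finset.prod_Ico_eq_prod_range _ (d * J), Nat.add_sub_cancel_left]
    congr 1
    refine Finset.prod_congr rfl fun m _ => ?_
    rw [Nat.cast_add, natCast_mul_self_zmod, zero_add]
  rw [coeffB, coeffC, lagCov, hsum, hdelta, htail, hN, Nat.add_sub_cancel_left, hcam, hprod]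
  split_ifs <;> ring

end Coefficients

/-! ### Mean, variance and covariances of block sums -/

section Blocks

lemma blockStar_shift {d J : ℕ} {Ω : Type*} (R : ℤ → Ω → ℝ) (m l : ℤ) :
    blockStar d J (fun n => R (m * ((d * J : ℕ) : ℤ) + n)) l = blockStar d J R (m + l) := by
  ext ω
  rw [blockStar, blockStar]
  refine Finset.sum_congr rfl fun j _ => ?_
  rw [show (m + l) * ((d * J : ℕ) : ℤ) + (j : ℤ) =
    m * ((d * J : ℕ) : ℤ) + (l * ((d * J : ℕ) : ℤ) + j) by ring]
  simp only [biPayoutStar, awardEvent, add_sub_assoc]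

variable {d J : ℕ} {M : FuturityMachine d J} {Ω : Type*} [mΩ : MeasurableSpace Ω] {P : Measure Ω}
  {R : ℤ → Ω → ℝ}

namespace IsBiinfinitePayouts

variable [IsProbabilityMeasure P]

lemma memLp_blockStar (h : M.IsBiinfinitePayouts P R) (m : ℤ) : MemLp (blockStar d J R m) 2 P :=
  memLp_finsetSum _ fun _ _ => h.memLp_biPayoutStar _

variable [NeZero (d * J)]

lemma integral_blockStar_zero (h : M.IsBiinfinitePayouts P R) :
    ∫ ω, blockStar d J R 0 ω ∂P = ((d * J : ℕ) : ℝ) * M.muStar := by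
  have hI : ((d * J : ℕ) : ℝ) ≠ 0 := Nat.cast_ne_zero.2 (NeZero.ne _)
  have hQ : 1 - M.Q ≠ 0 := by linarith [M.Q_lt_one]
  simp only [blockStar]
  rw [integral_finsetSum _ fun j _ => (h.memLp_biPayoutStar _).integrable one_le_two,
    sum_Icc_one_eq_sum_range]
  simp only [h.integral_biPayoutStar]
  have e : ∀ j : ℕ, ((0 * ((d * J : ℕ) : ℤ) + ((j + 1 : ℕ) : ℤ) - 1 : ℤ) : ZMod (d * J)) = j := by
    intro j
    push_cast
    ring
  simp only [e, Finset.sum_add_distrib, ← Finset.mul_sum, award, ← Finset.sum_div]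
  rw [muStar, pCirc]
  field_simp

lemma variance_blockStar_zero (h : M.IsBiinfinitePayouts P R) :
    Var[blockStar d J R 0; P] = M.varFormula := by
  have e : blockStar d J R 0 = fun ω => ∑ j ∈ Finset.Icc 1 (d * J), biPayoutStar J R (j : ℤ) ω := by
    ext ω
    simp [blockStar]
  rw [e, variance_fun_sum' fun j _ => h.memLp_biPayoutStar _,
    sum_sum_Icc_of_symm _ fun i j => covariance_comm _ _, varFormula]
  congr 1
  · rw [sum_Icc_one_eq_sum_range]
    refine Finset.sum_congr rfl fun j _ => ?_
    rw [covariance_self (h.memLp_biPayoutStar _).aemeasurable, h.variance_biPayoutStar]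
    have e : ((((j + 1 : ℕ) : ℤ) - 1 : ℤ) : ZMod (d * J)) = j := by
      push_cast
      ring
    rw [e]
  · congr 1
    refine Finset.sum_congr rfl fun j hj => Finset.sum_congr rfl fun i hi => ?_
    rw [Finset.mem_Icc] at hj
    rw [Finset.mem_Ico] at hi
    rw [M.coeffA_eq_lagCov hi.2 hj.2]
    have := h.cov_biPayoutStar i (n := j - i) (by omega)
    rw [show (i : ℤ) + ((j - i : ℕ) : ℤ) = j by omega] at this
    rw [this]
    push_cast
    rfl

/-- Relative to adjacent blocks, every lag has grown by `m` full turns, each worth a factor `Q`. -/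
lemma cov_blockStar_zero (h : M.IsBiinfinitePayouts P R) (m : ℕ) :
    cov[blockStar d J R 0, blockStar d J R ((m : ℤ) + 1); P] =
      M.Q ^ m * ((1 - M.Q) * M.covSumFormula) := by
  have hQ : 1 - M.Q ≠ 0 := by linarith [M.Q_lt_one]
  have e : ∀ m, blockStar d J R m =
      fun ω => ∑ j ∈ Finset.Icc 1 (d * J), biPayoutStar J R (m * ((d * J : ℕ) : ℤ) + j) ω :=
    fun m => rfl
  rw [e, e, covariance_fun_sum_fun_sum' (fun j _ => h.memLp_biPayoutStar _)
    (fun j _ => h.memLp_biPayoutStar _), covSumFormula, ← mul_assoc (1 - M.Q), mul_div_cancel₀ _ hQ,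
    Finset.mul_sum, Finset.mul_sum]
  refine Finset.sum_congr rfl fun i hi => ?_
  rw [Finset.mul_sum, Finset.mul_sum]
  refine Finset.sum_congr rfl fun j hj => ?_
  rw [Finset.mem_Icc] at hi hj
  rw [M.coeffBC_eq_lagCov hi.1 hi.2 hj.1 hj.2]
  have hpow : ∀ m : ℕ, M.lagCov ((i : ZMod (d * J)) - 1) (d * J + j - i + m * (d * J)) =
      M.Q ^ m * M.lagCov ((i : ZMod (d * J)) - 1) (d * J + j - i) := by
    intro m
    induction m with
    | zero => simp
    | succ m ih =>
      rw [add_mul, one_mul, ← add_assoc, lagCov_add_period _ _ (by omega), ih]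
      ring
  rw [← hpow]
  have := h.cov_biPayoutStar i (n := d * J + j - i + m * (d * J)) (by omega)
  rw [show (i : ℤ) + ((d * J + j - i + m * (d * J) : ℕ) : ℤ) =
    ((m : ℤ) + 1) * ((d * J : ℕ) : ℤ) + j by
      rw [Nat.cast_add, Nat.cast_sub (by omega)]; push_cast; ring] at this
  rw [zero_mul, zero_add, this]
  push_cast
  rfl

lemma hasSum_cov_blockStar (h : M.IsBiinfinitePayouts P R) :
    HasSum (fun m : ℕ => cov[blockStar d J R 0, blockStar d J R ((m : ℤ) + 1); P])
      M.covSumFormula := by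
  have hQ : 1 - M.Q ≠ 0 := by linarith [M.Q_lt_one]
  have hs := (hasSum_geometric_of_lt_one M.Q_pos.le M.Q_lt_one).mul_right
    ((1 - M.Q) * M.covSumFormula)
  rw [inv_mul_cancel_left₀ hQ] at hs
  exact hs.congr_fun fun m => h.cov_blockStar_zero m

lemma integral_blockStar (h : M.IsBiinfinitePayouts P R) (m : ℤ) :
    ∫ ω, blockStar d J R m ω ∂P = ((d * J : ℕ) : ℝ) * M.muStar := by
  have := (h.shift m).integral_blockStar_zero
  rwa [blockStar_shift, add_zero] at this

lemma variance_blockStar (h : M.IsBiinfinitePayouts P R) (m : ℤ) :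
    Var[blockStar d J R m; P] = M.varFormula := by
  have := (h.shift m).variance_blockStar_zero
  rwa [blockStar_shift, add_zero] at this

lemma cov_blockStar (h : M.IsBiinfinitePayouts P R) (l : ℤ) (m : ℕ) :
    cov[blockStar d J R l, blockStar d J R (l + ((m : ℤ) + 1)); P] =
      M.Q ^ m * ((1 - M.Q) * M.covSumFormula) := by
  have := (h.shift l).cov_blockStar_zero m
  rwa [blockStar_shift, blockStar_shift, add_zero] at this

/-- The variance of the total payout of `N` consecutive blocks grows like `N` times
`I (σ*)²`. -/
lemma tendsto_variance_sum_blockStar (h : M.IsBiinfinitePayouts P R) :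
    Tendsto (fun N : ℕ => Var[fun ω => ∑ m ∈ Finset.range N, blockStar d J R (m : ℤ) ω; P] / N)
      atTop (nhds (M.varFormula + 2 * M.covSumFormula)) := by
  -- By stationarity, the covariances of block `j` with the earlier blocks add up to the `j`-th
  -- partial sum of the covariance series. Dividing by `N` averages these partial sums.
  have hs := h.hasSum_cov_blockStar.tendsto_sum_nat.cesaro
  have hlim := (tendsto_const_nhds (x := M.varFormula)).add (hs.const_mul 2)
  refine hlim.congr' ?_
  filter_upwards [eventually_gt_atTop 0] with N hN
  have hN' : (N : ℝ) ≠ 0 := by positivity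
  rw [variance_fun_sum' fun m _ => h.memLp_blockStar _,
    sum_sum_range_of_symm _ fun i j => covariance_comm _ _]
  have hdiag : ∑ m ∈ Finset.range N, cov[blockStar d J R (m : ℤ), blockStar d J R (m : ℤ); P] =
      N * M.varFormula := by
    simp_rw [covariance_self (h.memLp_blockStar _).aemeasurable, h.variance_blockStar]
    simp
  have hoff : ∀ j : ℕ, ∑ i ∈ Finset.range j,
      cov[blockStar d J R (i : ℤ), blockStar d J R (j : ℤ); P] =
      ∑ i ∈ Finset.range j, cov[blockStar d J R 0, blockStar d J R ((i : ℤ) + 1); P] := by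
    intro j
    rw [← Finset.sum_range_reflect]
    refine Finset.sum_congr rfl fun i hi => ?_
    have := Finset.mem_range.1 hi
    have hc := h.cov_blockStar ((j - 1 - i : ℕ) : ℤ) i
    rw [show ((j - 1 - i : ℕ) : ℤ) + ((i : ℤ) + 1) = j by omega] at hc
    rw [hc, h.cov_blockStar_zero]
  rw [hdiag, Finset.sum_congr rfl fun j _ => hoff j]
  field_simp

end IsBiinfinitePayouts

end Blocks

/-! ### Strict positivity of the variance parameter -/

section Positivity

section Events

variable {Ω : Type*} {J : ℕ} {R : ℤ → Ω → ℝ}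

/-- Coups `n - 1` and `n + 1` are wins. -/
def winsAround (R : ℤ → Ω → ℝ) (n : ℤ) : Set Ω := {ω | 0 < R (n - 1) ω} ∩ {ω | 0 < R (n + 1) ω}

lemma measurableSet_winsAround_sigmaOn {S : Set ℤ} {n : ℤ} (h1 : n - 1 ∈ S) (h2 : n + 1 ∈ S) :
    MeasurableSet[sigmaOn R S] (winsAround R n) :=
  MeasurableSet.inter (measurable_sigmaOn R h1 measurableSet_Ioi)
    (measurable_sigmaOn R h2 measurableSet_Ioi)

/-- If coup `n + 1` is a win, then the payouts of all other coups do not depend on the outcome of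
coup `n`. -/
lemma biPayoutStar_update {n l : ℤ} (hl : l ≠ n) {ω : Ω} (hω : 0 < R (n + 1) ω) (X : Ω → ℝ) :
    biPayoutStar J (Function.update R n X) l ω = biPayoutStar J R l ω := by
  have key : ∀ k : ℕ, (0 < Function.update R n X (l - ((k * J : ℕ) : ℤ)) ω ∧
        ∀ m : ℕ, m < k * J → Function.update R n X (l - (m : ℤ)) ω = 0) ↔
      (0 < R (l - ((k * J : ℕ) : ℤ)) ω ∧ ∀ m : ℕ, m < k * J → R (l - (m : ℤ)) ω = 0) := by
    intro k
    have hup : ∀ a : ℤ, a ≠ n → Function.update R n X a ω = R a ω := fun a ha => by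
      rw [Function.update_of_ne ha]
    by_cases hc : l < n ∨ n < l - ((k * J : ℕ) : ℤ)
    · rw [hup _ (by omega)]
      refine and_congr_right fun _ => forall₂_congr fun m hm => ?_
      rw [hup _ (by omega)]
    -- A string ending at `l > n` that reaches back to `n` would include coup `n + 1`, a win, among
    -- its losses; so both sides are false.
    · have hlt : (l - n - 1).toNat < k * J := by omega
      have e : l - (((l - n - 1).toNat : ℕ) : ℤ) = n + 1 := by omega
      refine iff_of_false (fun h => ?_) fun h => ?_
      · have := h.2 _ hlt
        rw [e, hup _ (by omega)] at this
        exact hω.ne' this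
      · have := h.2 _ hlt
        rw [e] at this
        exact hω.ne' this
  have hA : ω ∈ awardEvent J (Function.update R n X) l ↔ ω ∈ awardEvent J R l := by
    simp only [awardEvent, Set.mem_ofPred_eq]
    exact exists_congr fun k => and_congr_right fun _ => key k
  rw [biPayoutStar, biPayoutStar, Function.update_of_ne hl]
  congr 1
  by_cases h : ω ∈ awardEvent J R l
  · simp [h, hA.2 h]
  · simp [h, mt hA.1 h]

/-- A string of losses beginning after coup `n - 1` has length at most `1 < J`. For `J = 1` every
loss is repaid with one coin, and if all wins pay one coin the payout is constant, so positivity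
would fail. -/
lemma biPayoutStar_eq_of_win (hJ : 2 ≤ J) {n : ℤ} {ω : Ω} (hω : 0 < R (n - 1) ω) :
    biPayoutStar J R n ω = R n ω := by
  rw [biPayoutStar, Set.indicator_of_notMem, add_zero]
  rintro ⟨k, hk, -, hloss⟩
  have := hloss 1 (by nlinarith)
  rw [Nat.cast_one] at this
  exact hω.ne' this

end Events

variable {d J : ℕ} {M : FuturityMachine d J} {Ω : Type*} [mΩ : MeasurableSpace Ω] {P : Measure Ω}
  {R : ℤ → Ω → ℝ}

/-- The fluctuation of the payout of coup `n`, if both adjacent coups are wins. -/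
def fluct (P : Measure Ω) (R : ℤ → Ω → ℝ) (n : ℤ) : Ω → ℝ :=
  (winsAround R n).indicator fun ω => R n ω - ∫ ω, R n ω ∂P

lemma measurable_fluct_sigmaOn {S : Set ℤ} {n : ℤ} (h : n ∈ S) (h1 : n - 1 ∈ S) (h2 : n + 1 ∈ S) :
    Measurable[sigmaOn R S] (fluct P R n) :=
  ((measurable_sigmaOn R h).sub_const _).indicator (measurableSet_winsAround_sigmaOn h1 h2)

namespace IsBiinfinitePayouts

lemma measurableSet_winsAround (h : M.IsBiinfinitePayouts P R) (n : ℤ) :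
    MeasurableSet (winsAround R n) :=
  sigmaOn_le h.measurable Set.univ _
    (measurableSet_winsAround_sigmaOn (Set.mem_univ _) (Set.mem_univ _))

lemma measureReal_winsAround (h : M.IsBiinfinitePayouts P R) (n : ℤ) :
    P.real (winsAround R n) = M.p ((n - 1 - 1 : ℤ) : ZMod (d * J)) *
      M.p ((n + 1 - 1 : ℤ) : ZMod (d * J)) := by
  rw [winsAround, measureReal_inter_of_sigmaOn (A := {ω | 0 < R (n - 1) ω})
    (B := {ω | 0 < R (n + 1) ω}) (S := {n - 1}) (T := {n + 1}) h.measurable h.indep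
    (by simp; omega) (measurable_sigmaOn R (Set.mem_singleton _) measurableSet_Ioi)
    (measurable_sigmaOn R (Set.mem_singleton _) measurableSet_Ioi), h.measureReal_pos, h.measureReal_pos]

variable [IsProbabilityMeasure P]

lemma memLp_fluct (h : M.IsBiinfinitePayouts P R) (n : ℤ) : MemLp (fluct P R n) 2 P :=
  ((h.memLp n).sub (memLp_const _)).indicator (h.measurableSet_winsAround n)

/-- The event `winsAround R n` and `f` do not involve coup `n`, whose centred payout is independent
of them and has mean zero. -/
lemma integral_mul_fluct (h : M.IsBiinfinitePayouts P R) (n : ℤ) {f : Ω → ℝ}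
    (hf : Measurable[sigmaOn R {n}ᶜ] f) : ∫ ω, f ω * fluct P R n ω ∂P = 0 := by
  have hg : Measurable[sigmaOn R {n}ᶜ] ((winsAround R n).indicator f) :=
    hf.indicator (measurableSet_winsAround_sigmaOn (by simp) (by simp))
  have hR : Measurable[sigmaOn R {n}] fun ω => R n ω - ∫ ω, R n ω ∂P :=
    (measurable_sigmaOn R (Set.mem_singleton _)).sub_const _
  have hi := indepFun_of_measurable_sigmaOn h.measurable h.indep
    disjoint_compl_left hg hR
  have e : ∀ ω, f ω * fluct P R n ω =
      (winsAround R n).indicator f ω * (R n ω - ∫ ω, R n ω ∂P) := by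
    intro ω
    by_cases hω : ω ∈ winsAround R n <;> simp [fluct, hω]
  simp_rw [e]
  rw [hi.integral_fun_mul_eq_mul_integral
    (hg.mono (sigmaOn_le h.measurable _) le_rfl).aestronglyMeasurable
    (hR.mono (sigmaOn_le h.measurable _) le_rfl).aestronglyMeasurable,
    integral_sub ((h.memLp n).integrable one_le_two) (integrable_const _)]
  simp

lemma integral_fluct (h : M.IsBiinfinitePayouts P R) (n : ℤ) : ∫ ω, fluct P R n ω ∂P = 0 := by
  simpa using h.integral_mul_fluct n (f := fun _ => 1) measurable_const

lemma cov_fluct (h : M.IsBiinfinitePayouts P R) {f : Ω → ℝ} (hf : MemLp f 2 P) (n : ℤ) :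
    cov[f, fluct P R n; P] = ∫ ω, f ω * fluct P R n ω ∂P := by
  rw [covariance_eq_sub hf (h.memLp_fluct n), h.integral_fluct, mul_zero, sub_zero]
  rfl

lemma integral_fluct_sq (h : M.IsBiinfinitePayouts P R) (n : ℤ) :
    ∫ ω, fluct P R n ω * fluct P R n ω ∂P = M.var ((n - 1 : ℤ) : ZMod (d * J)) *
      (M.p ((n - 1 - 1 : ℤ) : ZMod (d * J)) * M.p ((n + 1 - 1 : ℤ) : ZMod (d * J))) := by
  have e : ∀ ω, fluct P R n ω * fluct P R n ω =
      (winsAround R n).indicator (fun ω => (R n ω - ∫ ω, R n ω ∂P) ^ 2) ω := by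
    intro ω
    by_cases hω : ω ∈ winsAround R n <;> simp [fluct, hω, sq]
  simp_rw [e]
  rw [integral_indicator (h.measurableSet_winsAround n),
    setIntegral_of_measurable_sigmaOn (S := {n}) (T := {n}ᶜ) h.measurable h.indep
      disjoint_compl_right
      (((measurable_sigmaOn R (Set.mem_singleton _)).sub_const _).pow_const 2)
      (measurableSet_winsAround_sigmaOn (by simp) (by simp)),
    h.measureReal_winsAround, ← variance_eq_integral (h.measurable n).aemeasurable, h.variance_eq]

lemma cov_fluct_fluct (h : M.IsBiinfinitePayouts P R) {n l : ℤ} (h0 : l ≠ n) (h1 : l - 1 ≠ n)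
    (h2 : l + 1 ≠ n) : cov[fluct P R l, fluct P R n; P] = 0 := by
  rw [h.cov_fluct (h.memLp_fluct l)]
  exact h.integral_mul_fluct n (measurable_fluct_sigmaOn h0 h1 h2)

lemma cov_biPayoutStar_fluct_of_ne (h : M.IsBiinfinitePayouts P R) {n l : ℤ} (hl : l ≠ n) :
    cov[biPayoutStar J R l, fluct P R n; P] = 0 := by
  rw [h.cov_fluct (h.memLp_biPayoutStar l)]
  -- Where the fluctuation is nonzero, coup `n + 1` is a win, so the payout of coup `n` can be
  -- replaced by an arbitrary constant, here `1`, which removes all dependence on coup `n`.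
  have e : ∀ ω, biPayoutStar J R l ω * fluct P R n ω =
      biPayoutStar J (Function.update R n fun _ => 1) l ω * fluct P R n ω := by
    intro ω
    by_cases hω : ω ∈ winsAround R n
    · rw [biPayoutStar_update hl hω.2]
    · simp [fluct, hω]
  simp_rw [e]
  refine h.integral_mul_fluct n ?_
  refine @measurable_biPayoutStar Ω J (Function.update R n fun _ => 1) (sigmaOn R {n}ᶜ) l
    fun k _ => ?_
  by_cases hk : k = n
  · subst hk
    rw [Function.update_self]
    exact measurable_const
  · rw [Function.update_of_ne hk]
    exact measurable_sigmaOn R hk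

lemma cov_biPayoutStar_fluct_self (h : M.IsBiinfinitePayouts P R) (hJ : 2 ≤ J) (n : ℤ) :
    cov[biPayoutStar J R n, fluct P R n; P] = cov[fluct P R n, fluct P R n; P] := by
  rw [h.cov_fluct (h.memLp_biPayoutStar n), h.cov_fluct (h.memLp_fluct n)]
  have e : ∀ ω, biPayoutStar J R n ω * fluct P R n ω =
      fluct P R n ω * fluct P R n ω + (∫ ω, R n ω ∂P) * fluct P R n ω := by
    intro ω
    by_cases hω : ω ∈ winsAround R n
    · rw [biPayoutStar_eq_of_win hJ hω.1]
      simp only [fluct, hω, Set.indicator_of_mem]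
      ring
    · simp [fluct, hω]
  simp_rw [e]
  have hint : Integrable (fun ω => fluct P R n ω * fluct P R n ω) P :=
    (h.memLp_fluct n).integrable_mul (h.memLp_fluct n)
  rw [integral_add hint
    (((h.memLp_fluct n).integrable one_le_two).const_mul _), integral_const_mul, h.integral_fluct,
    mul_zero, add_zero]

variable [NeZero (d * J)]

/-- With `S` the block sum and `T` the sum of the fluctuations at the first coups of the blocks,
both `cov(S, T)` and `Var T` equal `N * v`. Hence `0 ≤ Var(S - T) = Var S - N * v`. -/
lemma le_variance_sum_blockStar (h : M.IsBiinfinitePayouts P R) (hJ : 2 ≤ J) (N : ℕ) :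
    N * (M.var 0 * (M.p (-1) * M.p 1)) ≤
      Var[fun ω => ∑ m ∈ Finset.range N, blockStar d J R (m : ℤ) ω; P] := by
  set v := M.var 0 * (M.p (-1) * M.p 1)
  set pos : ℕ → ℤ := fun m => (m : ℤ) * ((d * J : ℕ) : ℤ) + 1 with hpos
  have hIJ : 2 ≤ d * J := hJ.trans (Nat.le_mul_of_pos_left J (d_pos_of_neZero d J))
  have hv : ∀ m, cov[fluct P R (pos m), fluct P R (pos m); P] = v := by
    intro m
    rw [h.cov_fluct (h.memLp_fluct _), h.integral_fluct_sq]
    have e : ∀ a : ℤ, ((pos m + a : ℤ) : ZMod (d * J)) = ((1 + a : ℤ) : ZMod (d * J)) := by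
      intro a
      simp only [hpos]
      rw [add_assoc, Int.cast_add, Int.cast_mul, Int.cast_natCast (d * J), natCast_mul_self_zmod,
        mul_zero, zero_add]
    rw [show pos m - 1 = pos m + -1 by ring, show pos m + -1 - 1 = pos m + -2 by ring,
      show pos m + 1 - 1 = pos m + 0 by ring, e, e, e]
    norm_num [v]
  -- Distance two is enough for uncorrelated fluctuations, although they may then share a
  -- neighbouring win.
  have hsep : ∀ m m' : ℕ, m ≠ m' → pos m + 2 ≤ pos m' ∨ pos m' + 2 ≤ pos m := by
    intro m m' hmm
    simp only [hpos]
    rcases lt_or_gt_of_ne hmm with hlt | hlt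
    · left
      have : (m + 1) * (d * J) ≤ m' * (d * J) := Nat.mul_le_mul_right _ hlt
      zify at this hIJ
      push_cast
      linarith
    · right
      have : (m' + 1) * (d * J) ≤ m * (d * J) := Nat.mul_le_mul_right _ hlt
      zify at this hIJ
      push_cast
      linarith
  have hT : MemLp (fun ω => ∑ m ∈ Finset.range N, fluct P R (pos m) ω) 2 P :=
    memLp_finsetSum _ fun m _ => h.memLp_fluct _
  have hS : MemLp (fun ω => ∑ m ∈ Finset.range N, blockStar d J R (m : ℤ) ω) 2 P :=
    memLp_finsetSum _ fun m _ => h.memLp_blockStar _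
  have hVarT : Var[fun ω => ∑ m ∈ Finset.range N, fluct P R (pos m) ω; P] = N * v := by
    rw [variance_fun_sum' fun m _ => h.memLp_fluct _]
    have : ∀ m ∈ Finset.range N, ∑ m' ∈ Finset.range N,
        cov[fluct P R (pos m), fluct P R (pos m'); P] = v := by
      intro m hm
      rw [Finset.sum_eq_single_of_mem m hm, hv]
      intro m' _ hne
      have := hsep _ _ hne
      exact h.cov_fluct_fluct (by omega) (by omega) (by omega)
    rw [Finset.sum_congr rfl this]
    simp
  have hcov : cov[fun ω => ∑ m ∈ Finset.range N, blockStar d J R (m : ℤ) ω,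
      fun ω => ∑ m ∈ Finset.range N, fluct P R (pos m) ω; P] = N * v := by
    rw [covariance_fun_sum_right' (fun m _ => h.memLp_fluct _) hS]
    have : ∀ m ∈ Finset.range N, cov[fun ω => ∑ m ∈ Finset.range N, blockStar d J R (m : ℤ) ω,
        fluct P R (pos m); P] = v := by
      intro m hm
      rw [covariance_fun_sum_left' (fun m _ => h.memLp_blockStar _) (h.memLp_fluct _),
        Finset.sum_eq_single_of_mem m hm]
      · change cov[fun ω => ∑ j ∈ Finset.Icc 1 (d * J), biPayoutStar J R (_ + (j : ℤ)) ω, _; P] = v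
        rw [covariance_fun_sum_left' (fun m _ => h.memLp_biPayoutStar _) (h.memLp_fluct _),
          Finset.sum_eq_single_of_mem 1 (Finset.mem_Icc.2 ⟨le_rfl, by omega⟩)]
        · rw [Nat.cast_one]
          exact (h.cov_biPayoutStar_fluct_self hJ _).trans (hv m)
        · intro j _ hj
          refine h.cov_biPayoutStar_fluct_of_ne ?_
          simp only [hpos]
          omega
      · intro m' _ hne
        change cov[fun ω => ∑ j ∈ Finset.Icc 1 (d * J), biPayoutStar J R (_ + (j : ℤ)) ω, _; P] = 0
        rw [covariance_fun_sum_left' (fun m _ => h.memLp_biPayoutStar _) (h.memLp_fluct _)]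
        refine Finset.sum_eq_zero fun j hj => h.cov_biPayoutStar_fluct_of_ne ?_
        rw [Finset.mem_Icc] at hj
        simp only [hpos]
        intro hEq
        have hEq' : m' * (d * J) + (j - 1) = m * (d * J) := by
          zify [hj.1]
          push_cast at hEq
          linarith
        have hdvd : d * J ∣ j - 1 :=
          (Nat.dvd_add_right (Dvd.intro_left m' rfl)).1 (hEq' ▸ Dvd.intro_left m rfl)
        have h0 := Nat.eq_zero_of_dvd_of_lt hdvd (by omega)
        rw [h0, add_zero] at hEq'
        exact hne (Nat.eq_of_mul_eq_mul_right (by omega) hEq')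
    rw [Finset.sum_congr rfl this]
    simp
  have := variance_nonneg ((fun ω => ∑ m ∈ Finset.range N, blockStar d J R (m : ℤ) ω) -
    fun ω => ∑ m ∈ Finset.range N, fluct P R (pos m) ω) P
  rw [variance_sub hS hT, hVarT, hcov] at this
  linarith

end IsBiinfinitePayouts

variable (M)

/-- The joint law of the payouts of a machine which runs forever. -/
def canonicalMeasure : Measure (ℤ → ℝ) :=
  Measure.infinitePi fun n : ℤ => M.law ((n - 1 : ℤ) : ZMod (d * J))

instance : IsProbabilityMeasure M.canonicalMeasure := by
  unfold canonicalMeasure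
  infer_instance

lemma isBiinfinitePayouts_canonical :
    M.IsBiinfinitePayouts M.canonicalMeasure (fun n ω => ω n) where
  measurable n := measurable_pi_apply n
  indep := iIndepFun_infinitePi (X := fun _ x => x) fun _ => measurable_id
  map_eq n := Measure.infinitePi_map_eval _ n

/-- The parameter is defined without any probability space; the canonical one is used to read it as
a limit of variances. -/
lemma sigmaStarSq_pos [NeZero (d * J)] (hJ : 2 ≤ J) : 0 < M.sigmaStarSq := by
  have h := M.isBiinfinitePayouts_canonical
  have hv : 0 < M.var 0 * (M.p (-1) * M.p 1) :=
    mul_pos (M.var_pos _) (mul_pos (M.p_pos _) (M.p_pos _))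
  refine div_pos (hv.trans_le (ge_of_tendsto h.tendsto_variance_sum_blockStar ?_))
    (Nat.cast_pos.2 (NeZero.pos _))
  filter_upwards [eventually_gt_atTop 0] with N hN
  rw [le_div_iff₀ (by positivity), mul_comm]
  exact h.le_variance_sum_blockStar hJ N

end Positivity

/-! ### Sums along paths: stationary machine versus restarted machines -/

section PathSums

variable {Ω : Type*} {J : ℕ}

lemma measurable_pointer [MeasurableSpace Ω] {y : Ω → ℕ} (hy : Measurable y) {r : ℕ → Ω → ℝ}
    {n : ℕ} (hr : ∀ k < n, Measurable (r k)) :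
    Measurable fun ω => pointer J (y ω) (fun k => r k ω) n := by
  induction n with
  | zero => exact hy
  | succ n ih =>
    have ih' := ih fun k hk => hr k (hk.trans n.lt_succ_self)
    simp only [pointer]
    refine Measurable.ite (hr n n.lt_succ_self (measurableSet_singleton 0)) ?_ measurable_const
    exact Measurable.ite (ih' (measurableSet_singleton (J - 1))) measurable_const
      (ih'.add_const 1)

lemma measurableSet_pointer_award [MeasurableSpace Ω] {y : Ω → ℕ} (hy : Measurable y)
    {r : ℕ → Ω → ℝ} {n : ℕ} (hr : ∀ k ≤ n, Measurable (r k)) :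
    MeasurableSet {ω | pointer J (y ω) (fun k => r k ω) n = J - 1 ∧ r n ω = 0} :=
  MeasurableSet.inter
    (measurable_pointer hy (fun k hk => hr k hk.le) (measurableSet_singleton (J - 1)))
    (hr n le_rfl (measurableSet_singleton 0))

lemma measurable_payoutStar [MeasurableSpace Ω] {y : Ω → ℕ} (hy : Measurable y) {r : ℕ → Ω → ℝ}
    {n : ℕ} (hr : ∀ k ≤ n, Measurable (r k)) :
    Measurable fun ω => payoutStar J (y ω) (fun k => r k ω) n :=
  (hr n le_rfl).add (Measurable.ite (measurableSet_pointer_award hy hr) measurable_const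
    measurable_const)

lemma measurable_sum_payoutStar [MeasurableSpace Ω] {y : Ω → ℕ} (hy : Measurable y)
    {r : ℕ → Ω → ℝ} {n : ℕ} (hr : ∀ k < n, Measurable (r k)) :
    Measurable fun ω => ∑ l ∈ Finset.range n, payoutStar J (y ω) (fun k => r k ω) l :=
  Finset.measurable_fun_sum _ fun _ hl => measurable_payoutStar hy fun k hk =>
    hr k (hk.trans_lt (Finset.mem_range.1 hl))

/-- The total of the stationary payouts of coups `a + 1, …, a + n`. -/
def starSum (J : ℕ) (R : ℤ → Ω → ℝ) (a : ℤ) (n : ℕ) (ω : Ω) : ℝ :=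
  ∑ l ∈ Finset.range n, biPayoutStar J R (a + 1 + l) ω

/-- The total payout of coups `a + 1, …, a + n` if the pointer is put into position `y ω` before
coup `a + 1`. -/
def machineSum (J : ℕ) (y : Ω → ℕ) (R : ℤ → Ω → ℝ) (a : ℤ) (n : ℕ) (ω : Ω) : ℝ :=
  ∑ l ∈ Finset.range n, payoutStar J (y ω) (fun k => R (a + 1 + k) ω) l

variable {R : ℤ → Ω → ℝ}

lemma starSum_add (a : ℤ) (m n : ℕ) (ω : Ω) :
    starSum J R a (m + n) ω = starSum J R a m ω + starSum J R (a + m) n ω := by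
  rw [starSum, Finset.sum_range_add, starSum, starSum]
  congr 1
  refine Finset.sum_congr rfl fun l _ => ?_
  rw [show a + 1 + ((m + l : ℕ) : ℤ) = a + m + 1 + l by push_cast; ring]

lemma starSum_mul (L N : ℕ) (ω : Ω) :
    starSum J R 0 (N * L) ω = ∑ m ∈ Finset.range N, starSum J R ((m * L : ℕ) : ℤ) L ω := by
  induction N with
  | zero => simp [starSum]
  | succ N ih => rw [add_mul, one_mul, starSum_add, ih, Finset.sum_range_succ, zero_add]

lemma starSum_period (d : ℕ) (m : ℕ) :
    starSum J R ((m * (d * J) : ℕ) : ℤ) (d * J) = blockStar d J R m := by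
  ext ω
  rw [starSum, blockStar, sum_Icc_one_eq_sum_range]
  refine Finset.sum_congr rfl fun l _ => ?_
  congr 1
  push_cast
  ring

lemma starSum_zero_eq (d b : ℕ) :
    starSum J R 0 (b * (d * J)) = fun ω => ∑ m ∈ Finset.range b, blockStar d J R (m : ℤ) ω := by
  ext ω
  rw [starSum_mul]
  simp_rw [starSum_period]

lemma measurable_starSum_sigmaOn (a : ℤ) (n : ℕ) :
    Measurable[sigmaOn R (Set.Iic (a + n))] (starSum J R a n) := by
  refine @Finset.measurable_fun_sum _ _ _ _ _ _ (sigmaOn R (Set.Iic (a + n))) _ _ fun l hl => ?_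
  have := Finset.mem_range.1 hl
  exact (measurable_biPayoutStar_sigmaOn _).mono
    (sigmaOn_mono R (Set.Iic_subset_Iic.2 (by omega))) le_rfl

lemma measurable_machineSum_sigmaOn {S : Set ℤ} {y : Ω → ℕ} (hy : Measurable[sigmaOn R S] y)
    {a : ℤ} {n : ℕ} (hS : Set.Ioc a (a + n) ⊆ S) :
    Measurable[sigmaOn R S] (machineSum J y R a n) :=
  @measurable_sum_payoutStar Ω J (sigmaOn R S) y hy (fun k => R (a + 1 + k)) n fun k hk =>
    measurable_sigmaOn R (hS ⟨by omega, by omega⟩)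

/-- All payouts are nonnegative and every coup is preceded by a win. -/
def IsGoodPath (R : ℤ → Ω → ℝ) (ω : Ω) : Prop :=
  (∀ n, 0 ≤ R n ω) ∧ ∀ a, ∃ b ≤ a, 0 < R b ω

lemma IsGoodPath.abs_starSum_sub_machineSum_le {ω : Ω} (h : IsGoodPath R ω) (hJ : 0 < J)
    {y : Ω → ℕ} (hy : y ω < J) (a : ℤ) (n : ℕ) :
    |starSum J R a n ω - machineSum J y R a n ω| ≤ 2 * J := by
  obtain ⟨b, hba, hb⟩ := h.2 a
  obtain ⟨z, hz, he⟩ := exists_biPayoutStar_eq_payoutStar hJ h.1 hba hb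
  simp only [starSum, machineSum, he]
  exact abs_sum_payoutStar_sub_le hJ hz hy _ n

/-- After a win the machine restarted with pointer position `0` agrees with the stationary one. -/
lemma IsGoodPath.starSum_eq_machineSum {ω : Ω} (h : IsGoodPath R ω) (hJ : 0 < J) {a : ℤ} {g : ℕ}
    (hw : ω ∉ lossEvent R (a + g) g) (n : ℕ) :
    starSum J R (a + g) n ω =
      machineSum J (fun ω => pointer J 0 (fun k => R (a + 1 + k) ω) g) R (a + g) n ω := by
  obtain ⟨b, hba, hb⟩ := h.2 a
  obtain ⟨z, hz, he⟩ := exists_biPayoutStar_eq_payoutStar hJ h.1 hba hb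
  obtain ⟨m, hm, hm0⟩ : ∃ m < g, R (a + g - (m : ℤ)) ω ≠ 0 := by
    simpa [lossEvent] using hw
  -- The win among the coups `a + 1, …, a + g` merges the true pointer, which was `z` after coup
  -- `a`, with the one restarted at `0`.
  have hp := pointer_eq_of_win (J := J) z 0 (r := fun k => R (a + 1 + k) ω)
    (l := g - 1 - m) (n := g) (by omega)
    (by rwa [show a + 1 + ((g - 1 - m : ℕ) : ℤ) = a + g - m by omega])
  rw [starSum, machineSum]
  refine Finset.sum_congr rfl fun l _ => ?_
  have e : ∀ l : ℕ, a + (g : ℤ) + 1 + l = a + 1 + ((g + l : ℕ) : ℤ) := fun l => by push_cast; ring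
  simp only [e, he]
  rw [payoutStar_add, hp]

/-- The difference between the stationary payout of block `m` of length `L` and the payout of
that block if the pointer is reset to `0` at its beginning. -/
def carry (J : ℕ) (R : ℤ → Ω → ℝ) (L m : ℕ) (ω : Ω) : ℝ :=
  starSum J R ((m * L : ℕ) : ℤ) L ω - machineSum J (fun _ => 0) R ((m * L : ℕ) : ℤ) L ω

lemma measurable_carry_sigmaOn (L m : ℕ) :
    Measurable[sigmaOn R (Set.Iic (((m + 1) * L : ℕ) : ℤ))] (carry J R L m) := by
  refine Measurable.sub ?_ ?_
  · refine (measurable_starSum_sigmaOn _ _).mono (sigmaOn_mono R (Set.Iic_subset_Iic.2 ?_)) le_rfl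
    rw [add_mul]
    push_cast
    linarith
  · refine measurable_machineSum_sigmaOn measurable_const fun x hx => ?_
    rw [Set.mem_Iic, add_mul]
    push_cast at hx ⊢
    linarith [hx.2]

end PathSums

/-! ### The carry between blocks and its exponential decorrelation -/

section Carry

variable {Ω : Type*} {d J : ℕ} {M : FuturityMachine d J} [mΩ : MeasurableSpace Ω]
  {P : Measure Ω} {R : ℤ → Ω → ℝ}

/-- Both `E[XY]` and `E[X] E[Y]` are bounded in absolute value by `A * B * P(E)`. -/
lemma abs_cov_le [IsProbabilityMeasure P] {X Y : Ω → ℝ} {A B : ℝ} {E : Set Ω}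
    (hX : AEStronglyMeasurable X P) (hY : AEStronglyMeasurable Y P) (hA : ∀ᵐ ω ∂P, |X ω| ≤ A)
    (hE : MeasurableSet E) (hB : ∀ᵐ ω ∂P, |Y ω| ≤ E.indicator (fun _ => B) ω) (hA0 : 0 ≤ A)
    (hB0 : 0 ≤ B) : |cov[X, Y; P]| ≤ 2 * A * B * P.real E := by
  have hB' : ∀ᵐ ω ∂P, |Y ω| ≤ B := by
    filter_upwards [hB] with ω hω
    exact hω.trans (Set.indicator_le_self' (fun _ _ => hB0) ω)
  have hX2 : MemLp X 2 P := MemLp.of_bound hX A hA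
  have hY2 : MemLp Y 2 P := MemLp.of_bound hY B hB'
  have hind : ∫ ω, E.indicator (fun _ => B) ω ∂P = B * P.real E := by
    rw [integral_indicator_const _ hE, smul_eq_mul, mul_comm]
  have hindI : Integrable (E.indicator fun _ => B) P := (integrable_const B).indicator hE
  have h1 : |∫ ω, (X * Y) ω ∂P| ≤ A * (B * P.real E) := by
    rw [← hind, ← integral_const_mul]
    refine abs_integral_le_integral_abs.trans (integral_mono_ae (hX2.integrable_mul hY2).abs
      (hindI.const_mul A) ?_)
    filter_upwards [hA, hB] with ω h1 h2
    rw [Pi.mul_apply, abs_mul]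
    exact mul_le_mul h1 h2 (abs_nonneg _) hA0
  have h2 : |∫ ω, X ω ∂P| ≤ A := by
    refine abs_integral_le_integral_abs.trans ((integral_mono_ae
      (hX2.integrable one_le_two).abs (integrable_const A) hA).trans ?_)
    simp
  have h3 : |∫ ω, Y ω ∂P| ≤ B * P.real E := by
    rw [← hind]
    exact abs_integral_le_integral_abs.trans (integral_mono_ae
      (hY2.integrable one_le_two).abs hindI hB)
  rw [covariance_eq_sub hX2 hY2]
  refine (abs_sub _ _).trans ?_
  rw [abs_mul]
  have := mul_le_mul h2 h3 (abs_nonneg _) hA0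
  linarith

lemma lossProd_mul_period [NeZero (d * J)] (M : FuturityMachine d J) (a : ZMod (d * J)) (k : ℕ) :
    M.lossProd a (k * (d * J)) = M.Q ^ k := by
  induction k with
  | zero => simp [lossProd]
  | succ k ih => rw [add_mul, one_mul, lossProd_add_period, ih, pow_succ']

namespace IsBiinfinitePayouts

/-- An endless string of losses into the past has probability at most `r ^ L` for every `L`, with `r
< 1`. -/
lemma ae_isGoodPath [NeZero (d * J)] (h : M.IsBiinfinitePayouts P R) :
    ∀ᵐ ω ∂P, IsGoodPath R ω := by
  have := h.indep.isProbabilityMeasure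
  have hwin : ∀ᵐ ω ∂P, ∀ a : ℤ, ∃ L : ℕ, ω ∉ lossEvent R a L := by
    rw [ae_all_iff]
    intro a
    obtain ⟨r, h0, h1, hr⟩ := M.exists_q_le
    have hle : ∀ L : ℕ, P.real {ω | ¬ ∃ L : ℕ, ω ∉ lossEvent R a L} ≤ r ^ L := by
      intro L
      refine (measureReal_mono ?_).trans
        ((h.measureReal_lossEvent a L).le.trans (M.lossProd_le_pow hr _ _))
      intro ω hω
      by_contra hc
      exact hω ⟨L, hc⟩
    have := ge_of_tendsto' (tendsto_pow_atTop_nhds_zero_of_lt_one h0 h1) hle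
    rw [ae_iff, ← measureReal_eq_zero_iff]
    exact le_antisymm this measureReal_nonneg
  filter_upwards [h.ae_nonneg, hwin] with ω h0 hw
  refine ⟨h0, fun a => ?_⟩
  obtain ⟨L, hL⟩ := hw a
  obtain ⟨m, hm, hm0⟩ : ∃ m < L, R (a - (m : ℤ)) ω ≠ 0 := by simpa [lossEvent] using hL
  exact ⟨a - m, by omega, lt_of_le_of_ne (h0 _) (Ne.symm hm0)⟩

lemma ae_abs_carry_le [NeZero (d * J)] (h : M.IsBiinfinitePayouts P R) (L m : ℕ) :
    ∀ᵐ ω ∂P, |carry J R L m ω| ≤ 2 * J := by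
  filter_upwards [h.ae_isGoodPath] with ω hω
  exact hω.abs_starSum_sub_machineSum_le (J_pos_of_neZero d J) (J_pos_of_neZero d J) _ _

lemma measurable_carry (h : M.IsBiinfinitePayouts P R) (L m : ℕ) : Measurable (carry J R L m) :=
  (measurable_carry_sigmaOn L m).mono (sigmaOn_le h.measurable _) le_rfl

variable [IsProbabilityMeasure P]

lemma memLp_starSum (h : M.IsBiinfinitePayouts P R) (a : ℤ) (n : ℕ) :
    MemLp (starSum J R a n) 2 P :=
  memLp_finsetSum _ fun _ _ => h.memLp_biPayoutStar _

lemma memLp_machineSum (h : M.IsBiinfinitePayouts P R) {y : Ω → ℕ} (hy : Measurable y) (a : ℤ)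
    (n : ℕ) : MemLp (machineSum J y R a n) 2 P := by
  refine memLp_finsetSum _ fun l _ => (h.memLp _).add ?_
  refine MemLp.of_bound (Measurable.ite (measurableSet_pointer_award hy fun k _ =>
    h.measurable _) measurable_const measurable_const).aestronglyMeasurable J (ae_of_all _ fun ω => ?_)
  split_ifs <;> simp

variable [NeZero (d * J)]

lemma memLp_carry (h : M.IsBiinfinitePayouts P R) (L m : ℕ) : MemLp (carry J R L m) 2 P :=
  MemLp.of_bound (h.measurable_carry L m).aestronglyMeasurable _ (h.ae_abs_carry_le L m)

/-- Replace the later carry by `U`, in which the true pointer is replaced by one restarted at `0`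
right after block `m`. `U` depends only on later coups and is thus uncorrelated with the earlier
carry. It differs from the later carry only if no win occurs in the blocks between, and then by at
most `2 * J`. -/
lemma abs_cov_carry_le (h : M.IsBiinfinitePayouts P R) {b : ℕ} (hb : 1 ≤ b) {m m' : ℕ}
    (hm : m < m') :
    |cov[carry J R (b * (d * J)) m, carry J R (b * (d * J)) m'; P]| ≤
      16 * (J : ℝ) ^ 2 * M.Q ^ (m' - m - 1) := by
  have hJ := J_pos_of_neZero d J
  set L := b * (d * J) with hL
  obtain ⟨k, rfl⟩ := Nat.exists_eq_add_of_lt hm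
  rw [show m + k + 1 - m - 1 = k by omega]
  set a : ℤ := (((m + 1) * L : ℕ) : ℤ) with ha
  have hag : (((m + k + 1) * L : ℕ) : ℤ) = a + ((k * L : ℕ) : ℤ) := by
    rw [ha]
    push_cast
    ring
  set y : Ω → ℕ := fun ω => pointer J 0 (fun k => R (a + 1 + k) ω) (k * L) with hy
  set S : Set ℤ := Set.Ioi a with hS
  have hys : Measurable[sigmaOn R S] y :=
    @measurable_pointer Ω J (sigmaOn R S) (fun _ => 0) measurable_const (fun k => R (a + 1 + k))
      (k * L) fun j _ => measurable_sigmaOn R (by rw [hS, Set.mem_Ioi]; omega)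
  have hSsub : Set.Ioc (a + ((k * L : ℕ) : ℤ)) (a + ((k * L : ℕ) : ℤ) + L) ⊆ S := fun x hx => by
    rw [hS, Set.mem_Ioi]
    have := hx.1
    omega
  set U : Ω → ℝ := machineSum J y R (a + ((k * L : ℕ) : ℤ)) L -
    machineSum J (fun _ => 0) R (a + ((k * L : ℕ) : ℤ)) L with hU
  have hUm : Measurable[sigmaOn R S] U :=
    (measurable_machineSum_sigmaOn hys hSsub).sub
      (measurable_machineSum_sigmaOn measurable_const hSsub)
  have hU' : Measurable U := hUm.mono (sigmaOn_le h.measurable _) le_rfl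
  have hym : Measurable y := hys.mono (sigmaOn_le h.measurable _) le_rfl
  have hU2 : MemLp U 2 P :=
    (h.memLp_machineSum hym _ _).sub (h.memLp_machineSum measurable_const _ _)
  have hcX := h.memLp_carry L m
  have hcY := h.memLp_carry L (m + k + 1)
  have h0 : cov[carry J R L m, U; P] = 0 :=
    (indepFun_of_measurable_sigmaOn h.measurable h.indep
      (by rw [hS, Set.disjoint_left]; exact fun x hx hx' => (Set.mem_Iic.1 hx).not_gt (Set.mem_Ioi.1 hx'))
      (measurable_carry_sigmaOn L m) hUm).covariance_eq_zero hcX hU2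
  have hE : MeasurableSet (lossEvent R (a + ((k * L : ℕ) : ℤ)) (k * L)) :=
    measurableSet_lossEvent fun l _ _ => h.measurable l
  have hbound : ∀ᵐ ω ∂P, |(carry J R L (m + k + 1) - U) ω| ≤
      (lossEvent R (a + ((k * L : ℕ) : ℤ)) (k * L)).indicator (fun _ => (2 * J : ℝ)) ω := by
    filter_upwards [h.ae_isGoodPath] with ω hω
    have e : (carry J R L (m + k + 1) - U) ω =
        starSum J R (a + ((k * L : ℕ) : ℤ)) L ω - machineSum J y R (a + ((k * L : ℕ) : ℤ)) L ω := by
      rw [Pi.sub_apply, carry, hU, Pi.sub_apply, hag]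
      ring
    rw [e]
    by_cases hl : ω ∈ lossEvent R (a + ((k * L : ℕ) : ℤ)) (k * L)
    · rw [Set.indicator_of_mem hl]
      exact hω.abs_starSum_sub_machineSum_le hJ (pointer_lt hJ hJ _ _) _ _
    · rw [Set.indicator_of_notMem hl, hω.starSum_eq_machineSum hJ hl L, sub_self, abs_zero]
  have hsub : cov[carry J R L m, carry J R L (m + k + 1); P] =
      cov[carry J R L m, carry J R L (m + k + 1) - U; P] := by
    rw [covariance_sub_right hcX hcY hU2, h0, sub_zero]
  rw [hsub]
  refine (abs_cov_le hcX.aestronglyMeasurable (hcY.sub hU2).aestronglyMeasurable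
    (h.ae_abs_carry_le L m) hE hbound (by positivity) (by positivity)).trans ?_
  rw [h.measureReal_lossEvent, hL, ← mul_assoc k, lossProd_mul_period]
  -- Giving up the factor `b` in the exponent makes the bound uniform in the block length.
  have hpow : M.Q ^ (k * b) ≤ M.Q ^ k :=
    pow_le_pow_of_le_one M.Q_pos.le M.Q_lt_one.le (Nat.le_mul_of_pos_right k hb)
  have := M.Q_pos
  have h8 : 2 * (2 * (J : ℝ)) * (2 * J) * M.Q ^ (k * b) ≤ 8 * (J : ℝ) ^ 2 * M.Q ^ k := by
    have := mul_le_mul_of_nonneg_left hpow (show 0 ≤ 8 * (J : ℝ) ^ 2 by positivity)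
    linarith
  refine h8.trans ?_
  have : 0 ≤ (J : ℝ) ^ 2 * M.Q ^ k := by positivity
  linarith

lemma variance_carry_le (h : M.IsBiinfinitePayouts P R) (L m : ℕ) :
    Var[carry J R L m; P] ≤ 4 * (J : ℝ) ^ 2 := by
  refine (variance_le_expectation_sq (h.measurable_carry L m).aestronglyMeasurable).trans ?_
  have : ∫ _, 4 * (J : ℝ) ^ 2 ∂P = 4 * (J : ℝ) ^ 2 := by simp
  rw [← this]
  refine integral_mono_ae (h.memLp_carry L m).integrable_sq (integrable_const _) ?_
  filter_upwards [h.ae_abs_carry_le L m] with ω hω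
  rw [Pi.pow_apply, ← sq_abs]
  have := abs_nonneg (carry J R L m ω)
  nlinarith

/-- The geometric decay makes the double sum linear in `N`. The constant does not depend on `b`, so
the carries become negligible for long blocks. -/
lemma variance_sum_carry_le (h : M.IsBiinfinitePayouts P R) {b : ℕ} (hb : 1 ≤ b) (N : ℕ) :
    Var[fun ω => ∑ m ∈ Finset.range N, carry J R (b * (d * J)) m ω; P] ≤
      N * (4 * (J : ℝ) ^ 2 + 2 * (16 * (J : ℝ) ^ 2 * (1 - M.Q)⁻¹)) := by
  rw [variance_fun_sum' fun m _ => h.memLp_carry _ m,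
    sum_sum_range_of_symm _ fun i j => covariance_comm _ _]
  have hdiag : ∑ m ∈ Finset.range N,
      cov[carry J R (b * (d * J)) m, carry J R (b * (d * J)) m; P] ≤ N * (4 * (J : ℝ) ^ 2) := by
    refine (Finset.sum_le_card_nsmul _ _ (4 * (J : ℝ) ^ 2) fun m _ => ?_).trans (by simp)
    rw [covariance_self (h.memLp_carry _ m).aemeasurable]
    exact h.variance_carry_le _ m
  have hoff : ∑ j ∈ Finset.range N, ∑ i ∈ Finset.range j,
      cov[carry J R (b * (d * J)) i, carry J R (b * (d * J)) j; P] ≤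
        N * (16 * (J : ℝ) ^ 2 * (1 - M.Q)⁻¹) := by
    refine (Finset.sum_le_card_nsmul _ _ (16 * (J : ℝ) ^ 2 * (1 - M.Q)⁻¹) fun j _ => ?_).trans
      (by simp)
    refine (Finset.sum_le_sum fun i hi => (le_abs_self _).trans
      (h.abs_cov_carry_le hb (Finset.mem_range.1 hi))).trans ?_
    rw [← Finset.mul_sum, ← Finset.sum_range_reflect]
    refine mul_le_mul_of_nonneg_left ?_ (by positivity)
    rw [← tsum_geometric_of_lt_one M.Q_pos.le M.Q_lt_one]
    refine le_trans (Finset.sum_le_sum fun i hi => ?_)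
      ((summable_geometric_of_lt_one M.Q_pos.le M.Q_lt_one).sum_le_tsum (Finset.range j)
        fun _ _ => pow_nonneg M.Q_pos.le _)
    have := Finset.mem_range.1 hi
    rw [show j - (j - 1 - i) - 1 = i by omega]
  linarith

end IsBiinfinitePayouts

end Carry

/-! ### Comparison of characteristic functions and of variances -/

section Approximation

variable {Ω : Type*} [mΩ : MeasurableSpace Ω] {P : Measure Ω} [IsProbabilityMeasure P]

/-- Follows from `|exp(is) - 1| ≤ |s|`; it reduces weak approximation to `L¹` approximation. -/
lemma norm_charFun_map_sub_le {X Y : Ω → ℝ} (hX : AEMeasurable X P) (hY : AEMeasurable Y P)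
    (hXY : Integrable (fun ω => X ω - Y ω) P) (t : ℝ) :
    ‖charFun (P.map X) t - charFun (P.map Y) t‖ ≤ |t| * ∫ ω, |X ω - Y ω| ∂P := by
  have hI : ∀ {Z : Ω → ℝ}, AEMeasurable Z P →
      Integrable (fun ω => Complex.exp (t * Z ω * Complex.I)) P := by
    intro Z hZ
    refine Integrable.of_bound (AEMeasurable.aestronglyMeasurable (by fun_prop)) 1
      (ae_of_all _ fun ω => ?_)
    rw [← Complex.ofReal_mul, Complex.norm_exp_ofReal_mul_I]
  rw [charFun_apply_real, charFun_apply_real, integral_map hX (by fun_prop),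
    integral_map hY (by fun_prop), ← integral_sub (hI hX) (hI hY), ← integral_const_mul]
  refine (norm_integral_le_integral_norm _).trans
    (integral_mono ((hI hX).sub (hI hY)).norm (hXY.abs.const_mul _) fun ω => ?_)
  have e : Complex.exp (t * X ω * Complex.I) - Complex.exp (t * Y ω * Complex.I) =
      Complex.exp (((t * Y ω : ℝ) : ℂ) * Complex.I) *
        (Complex.exp (Complex.I * ((t * (X ω - Y ω) : ℝ) : ℂ)) - 1) := by
    rw [mul_sub, ← Complex.exp_add, mul_one]
    congr 2 <;> push_cast <;> ring
  change ‖Complex.exp (t * X ω * Complex.I) - Complex.exp (t * Y ω * Complex.I)‖ ≤ _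
  rw [e, norm_mul, Complex.norm_exp_ofReal_mul_I, one_mul]
  refine Real.norm_exp_I_mul_ofReal_sub_one_le.trans ?_
  rw [Real.norm_eq_abs, abs_mul]

lemma integral_abs_sub_integral_le {X : Ω → ℝ} (hX : MemLp X 2 P) :
    ∫ ω, |X ω - ∫ ω, X ω ∂P| ∂P ≤ √(Var[X; P]) := by
  have hY : MemLp (fun ω => |X ω - ∫ ω, X ω ∂P|) 2 P := (hX.sub (memLp_const _)).abs
  refine Real.le_sqrt_of_sq_le ?_
  have h := variance_nonneg (fun ω => |X ω - ∫ ω, X ω ∂P|) P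
  rw [variance_eq_sub hY] at h
  have e : ∫ ω, ((fun ω => |X ω - ∫ ω, X ω ∂P|) ^ 2) ω ∂P = Var[X; P] := by
    rw [variance_eq_integral hX.aemeasurable]
    exact integral_congr_ae (ae_of_all _ fun ω => sq_abs _)
  rw [e] at h
  linarith

/-- The covariance is controlled by `0 ≤ Var(X + cY)`, with a weight `c` to be chosen; the companion
lower bound uses `0 ≤ Var(X - cY)`. -/
lemma variance_sub_le {X Y : Ω → ℝ} (hX : MemLp X 2 P) (hY : MemLp Y 2 P) {c : ℝ} (hc : 0 < c) :
    Var[X - Y; P] ≤ (1 + c⁻¹) * Var[X; P] + (1 + c) * Var[Y; P] := by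
  have h := variance_nonneg (X + c • Y) P
  rw [variance_add hX (hY.const_smul c), variance_smul, covariance_smul_right] at h
  rw [variance_sub hX hY]
  have h2 := mul_nonneg (inv_nonneg.2 hc.le) h
  have e : c⁻¹ * (Var[X; P] + 2 * (c * cov[X, Y; P]) + c ^ 2 * Var[Y; P]) =
      c⁻¹ * Var[X; P] + 2 * cov[X, Y; P] + c * Var[Y; P] := by
    field_simp
  linarith

lemma le_variance_sub {X Y : Ω → ℝ} (hX : MemLp X 2 P) (hY : MemLp Y 2 P) {c : ℝ} (hc : 0 < c) :
    (1 - c⁻¹) * Var[X; P] - c * Var[Y; P] ≤ Var[X - Y; P] := by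
  have h := variance_nonneg (X - c • Y) P
  rw [variance_sub hX (hY.const_smul c), variance_smul, covariance_smul_right] at h
  rw [variance_sub hX hY]
  have h2 := mul_nonneg (inv_nonneg.2 hc.le) h
  have e : c⁻¹ * (Var[X; P] - 2 * (c * cov[X, Y; P]) + c ^ 2 * Var[Y; P]) =
      c⁻¹ * Var[X; P] - 2 * cov[X, Y; P] + c * Var[Y; P] := by
    field_simp
  linarith [variance_nonneg Y P]

end Approximation

/-! ### Independent identically distributed block payouts -/

section FreshBlocks

variable {Ω : Type*} {d J : ℕ} {M : FuturityMachine d J} [mΩ : MeasurableSpace Ω]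
  {P : Measure Ω} {R : ℤ → Ω → ℝ}

/-- The total payout in block `m` of length `L` if the pointer is reset to `0` at its beginning. -/
def fresh (J : ℕ) (R : ℤ → Ω → ℝ) (L m : ℕ) : Ω → ℝ :=
  machineSum J (fun _ => 0) R ((m * L : ℕ) : ℤ) L

lemma measurable_machineSum_coords (J y : ℕ) (a : ℤ) (n : ℕ) :
    Measurable (machineSum J (fun _ => y) (fun (k : ℤ) (x : ℤ → ℝ) => x k) a n) :=
  measurable_sum_payoutStar (r := fun k (x : ℤ → ℝ) => x (a + 1 + k)) measurable_const
    fun _ _ => measurable_pi_apply _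

namespace IsBiinfinitePayouts

lemma map_eq_canonical (h : M.IsBiinfinitePayouts P R) :
    P.map (fun ω n => R n ω) = M.canonicalMeasure := by
  rw [h.indep.map_fun_eq_infinitePi_map h.measurable, canonicalMeasure]
  simp_rw [h.map_eq]

lemma iIndepFun_fresh (h : M.IsBiinfinitePayouts P R) (L : ℕ) : iIndepFun (fresh J R L) P := by
  refine iIndepFun_of_measurable_sigmaOn h.measurable h.indep
    (S := fun m => Set.Ioc ((m * L : ℕ) : ℤ) (((m * L : ℕ) : ℤ) + L)) ?_
    fun m => measurable_machineSum_sigmaOn measurable_const subset_rfl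
  have key : ∀ m m' : ℕ, m < m' → Disjoint (Set.Ioc ((m * L : ℕ) : ℤ) (((m * L : ℕ) : ℤ) + L))
      (Set.Ioc ((m' * L : ℕ) : ℤ) (((m' * L : ℕ) : ℤ) + L)) := by
    intro m m' hlt
    have : (m + 1) * L ≤ m' * L := Nat.mul_le_mul_right _ hlt
    rw [add_mul, one_mul] at this
    rw [Set.disjoint_left]
    intro x hx hx'
    have h1 := hx.2
    have h2 := hx'.1
    omega
  intro m m' hne
  rcases lt_or_gt_of_ne hne with hlt | hlt
  · exact key m m' hlt
  · exact (key m' m hlt).symm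

/-- All block payouts are the same functional `Φ` of the path, shifted by whole turns of the cam,
and such shifts preserve the law of the path. -/
lemma identDistrib_fresh (h : M.IsBiinfinitePayouts P R) (b m : ℕ) :
    IdentDistrib (fresh J R (b * (d * J)) m) (fresh J R (b * (d * J)) 0) P P := by
  set Φ := machineSum J (fun _ => 0) (fun (k : ℤ) (x : ℤ → ℝ) => x k) 0 (b * (d * J)) with hΦ
  have hΦm : Measurable Φ := measurable_machineSum_coords J 0 0 _
  have e : ∀ m : ℕ, fresh J R (b * (d * J)) m =
      Φ ∘ fun ω n => R (((m * b : ℕ) : ℤ) * ((d * J : ℕ) : ℤ) + n) ω := by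
    intro m
    ext ω
    simp only [fresh, hΦ, machineSum, Function.comp_apply]
    refine Finset.sum_congr rfl fun l _ => ?_
    congr 1
    ext k
    congr 1
    push_cast
    ring
  have hm : ∀ m : ℕ, Measurable (fun ω n => R (((m * b : ℕ) : ℤ) * ((d * J : ℕ) : ℤ) + n) ω) :=
    fun m => measurable_pi_lambda _ fun n => h.measurable _
  refine ⟨?_, ?_, ?_⟩
  · rw [e]
    exact (hΦm.comp (hm m)).aemeasurable
  · rw [e]
    exact (hΦm.comp (hm 0)).aemeasurable
  · rw [e, e, ← Measure.map_map hΦm (hm m), ← Measure.map_map hΦm (hm 0),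
      (h.shift _).map_eq_canonical, (h.shift _).map_eq_canonical]

variable [IsProbabilityMeasure P]

lemma memLp_fresh (h : M.IsBiinfinitePayouts P R) (L m : ℕ) : MemLp (fresh J R L m) 2 P :=
  h.memLp_machineSum measurable_const _ _

lemma tendsto_charFun_fresh (h : M.IsBiinfinitePayouts P R) (b : ℕ) (t : ℝ) :
    Tendsto (fun N : ℕ => charFun (P.map fun ω => (√N)⁻¹ *
        (∑ m ∈ Finset.range N, fresh J R (b * (d * J)) m ω -
          N * ∫ ω, fresh J R (b * (d * J)) 0 ω ∂P)) t)
      atTop (nhds (Complex.exp (-(Var[fresh J R (b * (d * J)) 0; P] * t ^ 2 / 2)))) := by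
  have hT := tendstoInDistribution_inv_sqrt_mul_sum_sub
    (Y := fun x : ℝ => x) (P' := gaussianReal 0 Var[fresh J R (b * (d * J)) 0; P].toNNReal)
    ⟨by fun_prop, Measure.map_id'⟩ (h.memLp_fresh _ 0) (h.iIndepFun_fresh _)
    (h.identDistrib_fresh b)
  have := ProbabilityMeasure.tendsto_iff_tendsto_charFun.1 hT.tendsto t
  simp only [ProbabilityMeasure.coe_mk, Measure.map_id', charFun_gaussianReal,
    Real.coe_toNNReal _ (variance_nonneg _ _)] at this
  simpa using this

lemma integral_abs_starSum_le (h : M.IsBiinfinitePayouts P R) {B : ℝ}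
    (hB : ∀ n, ∫ ω, |biPayoutStar J R n ω| ∂P ≤ B) (a : ℤ) (n : ℕ) :
    ∫ ω, |starSum J R a n ω| ∂P ≤ n * B := by
  have hi : ∀ l, Integrable (fun ω => |biPayoutStar J R l ω|) P := fun l =>
    ((h.memLp_biPayoutStar l).integrable one_le_two).abs
  refine (integral_mono ((h.memLp_starSum a n).integrable one_le_two).abs
    (integrable_finsetSum (Finset.range n) fun (l : ℕ) _ => hi (a + 1 + l))
    fun ω => Finset.abs_sum_le_sum_abs (fun l : ℕ => biPayoutStar J R (a + 1 + l) ω) _).trans ?_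
  rw [integral_finsetSum _ fun (l : ℕ) _ => hi (a + 1 + l)]
  refine (Finset.sum_le_card_nsmul _ _ B fun l _ => hB _).trans ?_
  simp

variable [NeZero (d * J)]

lemma integral_starSum_zero (h : M.IsBiinfinitePayouts P R) (b : ℕ) :
    ∫ ω, starSum J R 0 (b * (d * J)) ω ∂P = ((b * (d * J) : ℕ) : ℝ) * M.muStar := by
  rw [starSum_zero_eq, integral_finsetSum _ fun m _ => (h.memLp_blockStar _).integrable one_le_two]
  simp_rw [h.integral_blockStar]
  rw [Finset.sum_const, Finset.card_range, nsmul_eq_mul]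
  push_cast
  ring

/-- A fresh block is a sum of `b` stationary blocks minus one carry of variance at most `4 * J ^ 2`.
The weight `√b` in the variance inequalities makes both errors vanish after division by `b`. -/
lemma tendsto_variance_fresh (h : M.IsBiinfinitePayouts P R) :
    Tendsto (fun b : ℕ => Var[fresh J R (b * (d * J)) 0; P] / b) atTop
      (nhds (M.varFormula + 2 * M.covSumFormula)) := by
  set s := M.varFormula + 2 * M.covSumFormula
  have hV := h.tendsto_variance_sum_blockStar
  have hsq : Tendsto (fun b : ℕ => (√(b : ℝ))⁻¹) atTop (nhds 0) :=
    tendsto_inv_atTop_zero.comp (Real.tendsto_sqrt_atTop.comp tendsto_natCast_atTop_atTop)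
  have hinv : Tendsto (fun b : ℕ => ((b : ℝ))⁻¹) atTop (nhds 0) :=
    tendsto_inv_atTop_zero.comp tendsto_natCast_atTop_atTop
  have hup : Tendsto (fun b : ℕ => (1 + (√(b : ℝ))⁻¹) *
      (Var[fun ω => ∑ m ∈ Finset.range b, blockStar d J R (m : ℤ) ω; P] / b) +
        ((b : ℝ)⁻¹ + (√(b : ℝ))⁻¹) * (4 * (J : ℝ) ^ 2)) atTop (nhds s) := by
    have := (((tendsto_const_nhds (x := (1 : ℝ))).add hsq).mul hV).add
      ((hinv.add hsq).mul_const (4 * (J : ℝ) ^ 2))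
    simpa using this
  have hlow : Tendsto (fun b : ℕ => (1 - (√(b : ℝ))⁻¹) *
      (Var[fun ω => ∑ m ∈ Finset.range b, blockStar d J R (m : ℤ) ω; P] / b) -
        (√(b : ℝ))⁻¹ * (4 * (J : ℝ) ^ 2)) atTop (nhds s) := by
    have := (((tendsto_const_nhds (x := (1 : ℝ))).sub hsq).mul hV).sub
      (hsq.mul_const (4 * (J : ℝ) ^ 2))
    simpa using this
  have he : ∀ b : ℕ, fresh J R (b * (d * J)) 0 =
      (fun ω => ∑ m ∈ Finset.range b, blockStar d J R (m : ℤ) ω) - carry J R (b * (d * J)) 0 := by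
    intro b
    rw [← starSum_zero_eq]
    ext ω
    simp [fresh, carry]
  have hS : ∀ b : ℕ, MemLp (fun ω => ∑ m ∈ Finset.range b, blockStar d J R (m : ℤ) ω) 2 P :=
    fun b => memLp_finsetSum _ fun m _ => h.memLp_blockStar _
  have hdiv : ∀ b : ℕ, 0 < b → √(b : ℝ) / b = (√(b : ℝ))⁻¹ := by
    intro b hb
    have : 0 < (b : ℝ) := by exact_mod_cast hb
    rw [div_eq_iff this.ne', inv_mul_eq_div, Real.div_sqrt]
  refine tendsto_of_tendsto_of_tendsto_of_le_of_le' hlow hup ?_ ?_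
  · filter_upwards [eventually_gt_atTop 0] with b hb
    have hb' : 0 < (b : ℝ) := by exact_mod_cast hb
    have hle := le_variance_sub (hS b) (h.memLp_carry (b * (d * J)) 0) (Real.sqrt_pos.2 hb')
    rw [← he] at hle
    have hc := mul_le_mul_of_nonneg_left (h.variance_carry_le (b * (d * J)) 0)
      (Real.sqrt_nonneg (b : ℝ))
    rw [← hdiv b hb, div_mul_eq_mul_div _ _ (4 * (J : ℝ) ^ 2), ← mul_div_assoc, ← sub_div, hdiv b hb]
    gcongr
    linarith
  · filter_upwards [eventually_gt_atTop 0] with b hb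
    have hb' : 0 < (b : ℝ) := by exact_mod_cast hb
    have hle := variance_sub_le (hS b) (h.memLp_carry (b * (d * J)) 0) (Real.sqrt_pos.2 hb')
    rw [← he] at hle
    have hc := mul_le_mul_of_nonneg_left (h.variance_carry_le (b * (d * J)) 0)
      (show 0 ≤ 1 + √(b : ℝ) by positivity)
    have e : (b : ℝ)⁻¹ + (√(b : ℝ))⁻¹ = (1 + √(b : ℝ)) / b := by
      rw [add_div, hdiv b hb, one_div]
    rw [e, div_mul_eq_mul_div _ _ (4 * (J : ℝ) ^ 2), ← mul_div_assoc, ← add_div]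
    gcongr
    linarith

lemma exists_integral_abs_biPayoutStar_le (h : M.IsBiinfinitePayouts P R) :
    ∃ B : ℝ, 0 ≤ B ∧ ∀ n, ∫ ω, |biPayoutStar J R n ω| ∂P ≤ B := by
  have hb : ∀ i : ZMod (d * J), 0 ≤ M.mean i + J * M.award i := by
    intro i
    refine add_nonneg (integral_nonneg_of_ae (M.payout_nonneg i)) (mul_nonneg (Nat.cast_nonneg _) ?_)
    exact (M.hasSum_run i).nonneg fun k => M.run_nonneg _ _
  refine ⟨∑ i : ZMod (d * J), (M.mean i + J * M.award i), Finset.sum_nonneg fun i _ => hb i,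
    fun n => ?_⟩
  have e : ∫ ω, |biPayoutStar J R n ω| ∂P = ∫ ω, biPayoutStar J R n ω ∂P := by
    refine integral_congr_ae ?_
    filter_upwards [h.ae_nonneg] with ω hω
    refine abs_of_nonneg (add_nonneg (hω n) (Set.indicator_nonneg (fun _ _ => Nat.cast_nonneg J) ω))
  rw [e, h.integral_biPayoutStar]
  exact Finset.single_le_sum (f := fun i => M.mean i + J * M.award i) (fun i _ => hb i)
    (Finset.mem_univ _)

end IsBiinfinitePayouts

end FreshBlocks

/-! ### The central limit theorem -/

section CentralLimit

variable {Ω : Type*} {d J : ℕ} {M : FuturityMachine d J} [mΩ : MeasurableSpace Ω]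
  {P : Measure Ω} {R : ℤ → Ω → ℝ}

namespace IsBiinfinitePayouts

variable [IsProbabilityMeasure P]

lemma integral_sum_fresh (h : M.IsBiinfinitePayouts P R) (b N : ℕ) :
    ∫ ω, ∑ m ∈ Finset.range N, fresh J R (b * (d * J)) m ω ∂P =
      N * ∫ ω, fresh J R (b * (d * J)) 0 ω ∂P := by
  rw [integral_finsetSum _ fun m _ => (h.memLp_fresh _ m).integrable one_le_two,
    Finset.sum_congr rfl fun m _ => (h.identDistrib_fresh b m).integral_eq]
  simp

lemma variance_sum_fresh (h : M.IsBiinfinitePayouts P R) (b N : ℕ) :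
    Var[fun ω => ∑ m ∈ Finset.range N, fresh J R (b * (d * J)) m ω; P] =
      N * Var[fresh J R (b * (d * J)) 0; P] := by
  have hv := IndepFun.variance_sum (μ := P) (X := fresh J R (b * (d * J))) (s := Finset.range N)
    (fun m _ => h.memLp_fresh _ m) fun i _ j _ hij => (h.iIndepFun_fresh _).indepFun hij
  have e : (fun ω => ∑ m ∈ Finset.range N, fresh J R (b * (d * J)) m ω) =
      ∑ m ∈ Finset.range N, fresh J R (b * (d * J)) m := by
    ext ω
    simp
  rw [e, hv, Finset.sum_congr rfl fun m _ => (h.identDistrib_fresh b m).variance_eq]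
  simp

variable [NeZero (d * J)]

/-- The total payout of the machine is within bounded `L¹`-distance of the sum of independent
identically distributed block payouts, up to an error whose variance is small compared to the
block length. -/
lemma exists_integral_abs_machineSum_sub_le (h : M.IsBiinfinitePayouts P R) {b : ℕ} (hb : 1 ≤ b)
    (a j₀ : ℕ) (hj : j₀ < J) : ∃ K : ℝ, 0 ≤ K ∧ ∀ n : ℕ,
      ∫ ω, |(machineSum J (fun _ => j₀) R a n ω - n * M.muStar) -
        (∑ m ∈ Finset.range (n / (b * (d * J))), fresh J R (b * (d * J)) m ω -
          (n / (b * (d * J)) : ℕ) * ∫ ω, fresh J R (b * (d * J)) 0 ω ∂P)| ∂P ≤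
      K + √((n / (b * (d * J)) : ℕ) *
        (4 * (J : ℝ) ^ 2 + 2 * (16 * (J : ℝ) ^ 2 * (1 - M.Q)⁻¹))) := by
  have hJ := J_pos_of_neZero d J
  set L := b * (d * J) with hL
  have hLpos : 0 < L := Nat.mul_pos hb (NeZero.pos _)
  obtain ⟨B, hB0, hB⟩ := h.exists_integral_abs_biPayoutStar_le
  -- The terms of the constant: the coupling of the pointers; the two ends created by moving the
  -- window of coups from `a + 1, …, a + n` to `1, …, n`; the incomplete last block; and the mean of
  -- that block.
  refine ⟨2 * J + a * B + a * B + L * B + L * |M.muStar|, by positivity, fun n => ?_⟩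
  set N := n / L with hN
  set e := ∫ ω, fresh J R L 0 ω ∂P with he
  set C : Ω → ℝ := fun ω => ∑ m ∈ Finset.range N, carry J R L m ω with hC
  have hn : N * L + n % L = n := by
    rw [hN, mul_comm]
    exact Nat.div_add_mod n L
  have hr : n % L < L := Nat.mod_lt _ hLpos
  have hC2 : MemLp C 2 P := memLp_finsetSum _ fun m _ => h.memLp_carry _ m
  have hCF : ∀ ω, starSum J R 0 (N * L) ω = ∑ m ∈ Finset.range N, fresh J R L m ω + C ω := by
    intro ω
    rw [starSum_mul, hC, ← Finset.sum_add_distrib]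
    refine Finset.sum_congr rfl fun m _ => ?_
    rw [fresh, carry]
    ring
  -- The mean `e` of a fresh block is not `L` times `muStar`; the mean of the carries makes up
  -- exactly for the difference, so only their centred sum remains.
  have hCint : ∫ ω, C ω ∂P = N * L * M.muStar - N * e := by
    have h1 := h.integral_starSum_zero (N * b)
    rw [mul_assoc, ← hL] at h1
    simp_rw [hCF] at h1
    rw [integral_add (integrable_finsetSum _ fun m _ => (h.memLp_fresh L m).integrable one_le_two)
      (hC2.integrable one_le_two), h.integral_sum_fresh] at h1
    push_cast at h1
    linarith
  have hid : ∀ ω, (machineSum J (fun _ => j₀) R a n ω - n * M.muStar) -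
      (∑ m ∈ Finset.range N, fresh J R L m ω - N * e) =
      -(starSum J R a n ω - machineSum J (fun _ => j₀) R a n ω) + (starSum J R n a ω -
        starSum J R 0 a ω + starSum J R ((N * L : ℕ) : ℤ) (n % L) ω) - (n % L : ℕ) * M.muStar +
        (C ω - ∫ ω, C ω ∂P) := by
    intro ω
    have h1 := starSum_add (J := J) (R := R) 0 a n ω
    have h2 := starSum_add (J := J) (R := R) 0 n a ω
    have h3 := starSum_add (J := J) (R := R) 0 (N * L) (n % L) ω
    have h4 := hCF ω
    have h5 : (n : ℝ) = N * L + (n % L : ℕ) := by exact_mod_cast hn.symm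
    rw [add_comm n a] at h2
    rw [hn] at h3
    simp only [zero_add] at h1 h2 h3
    rw [hCint, h5]
    linarith
  simp_rw [hid]
  have hle : ∀ᵐ ω ∂P, |-(starSum J R a n ω - machineSum J (fun _ => j₀) R a n ω) +
      (starSum J R n a ω - starSum J R 0 a ω + starSum J R ((N * L : ℕ) : ℤ) (n % L) ω) -
        (n % L : ℕ) * M.muStar + (C ω - ∫ ω, C ω ∂P)| ≤
      ((2 * J + L * |M.muStar|) + |starSum J R n a ω|) + (|starSum J R 0 a ω| +
        |starSum J R ((N * L : ℕ) : ℤ) (n % L) ω|) + |C ω - ∫ ω, C ω ∂P| := by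
    filter_upwards [h.ae_isGoodPath] with ω hω
    have h1 := hω.abs_starSum_sub_machineSum_le hJ (y := fun _ => j₀) hj a n
    have h2 : |((n % L : ℕ) : ℝ) * M.muStar| ≤ L * |M.muStar| := by
      rw [abs_mul, Nat.abs_cast]
      exact mul_le_mul_of_nonneg_right (by exact_mod_cast hr.le) (abs_nonneg _)
    refine (abs_add_le _ _).trans (add_le_add ?_ le_rfl)
    refine (abs_sub _ _).trans ?_
    refine (add_le_add (abs_add_le _ _) h2).trans ?_
    rw [abs_neg]
    have h3 := abs_add_le (starSum J R n a ω - starSum J R 0 a ω)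
      (starSum J R ((N * L : ℕ) : ℤ) (n % L) ω)
    have h4 := abs_sub (starSum J R n a ω) (starSum J R 0 a ω)
    linarith
  have iS : ∀ (x : ℤ) (k : ℕ), Integrable (fun ω => |starSum J R x k ω|) P := fun x k =>
    ((h.memLp_starSum x k).integrable one_le_two).abs
  have iC : Integrable (fun ω => |C ω - ∫ ω, C ω ∂P|) P :=
    ((hC2.sub (memLp_const _)).integrable one_le_two).abs
  have i1 : Integrable (fun ω => (2 * J + L * |M.muStar|) + |starSum J R n a ω|) P :=
    (integrable_const _).add (iS n a)
  have i2 : Integrable (fun ω => |starSum J R 0 a ω| +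
      |starSum J R ((N * L : ℕ) : ℤ) (n % L) ω|) P := (iS 0 a).add (iS _ _)
  have i12 : Integrable (fun ω => ((2 * J + L * |M.muStar|) + |starSum J R n a ω|) +
      (|starSum J R 0 a ω| + |starSum J R ((N * L : ℕ) : ℤ) (n % L) ω|)) P := i1.add i2
  refine (integral_mono_of_nonneg (ae_of_all _ fun _ => abs_nonneg _) (i12.add iC) hle).trans ?_
  simp only [Pi.add_apply]
  rw [integral_add i12 iC, integral_add i1 i2, integral_add (integrable_const _) (iS n a),
    integral_add (iS 0 a) (iS _ _)]
  have b1 := h.integral_abs_starSum_le hB n a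
  have b2 := h.integral_abs_starSum_le hB 0 a
  have b3 := h.integral_abs_starSum_le hB ((N * L : ℕ) : ℤ) (n % L)
  have b4 : ((n % L : ℕ) : ℝ) * B ≤ L * B :=
    mul_le_mul_of_nonneg_right (by exact_mod_cast hr.le) hB0
  have b5 := (integral_abs_sub_integral_le hC2).trans
    (Real.sqrt_le_sqrt (h.variance_sum_carry_le hb N))
  have b6 : ∫ _, (2 * J + L * |M.muStar| : ℝ) ∂P = 2 * J + L * |M.muStar| := by simp
  rw [b6]
  linarith

/-- Convergence of the characteristic functions of the normalized total payouts. -/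
lemma tendsto_charFun_machineSum (h : M.IsBiinfinitePayouts P R) (hσ : 0 < M.sigmaStarSq)
    (a j₀ : ℕ) (hj : j₀ < J) (t : ℝ) :
    Tendsto (fun n : ℕ => charFun (P.map fun ω =>
        (machineSum J (fun _ => j₀) R a n ω - n * M.muStar) / √(n * M.sigmaStarSq)) t)
      atTop (nhds (Complex.exp (-(t ^ 2 / 2 : ℝ)))) := by
  set σ2 := M.sigmaStarSq with hσ2
  set C0 := 4 * (J : ℝ) ^ 2 + 2 * (16 * (J : ℝ) ^ 2 * (1 - M.Q)⁻¹) with hC0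
  have hI : (0 : ℝ) < ((d * J : ℕ) : ℝ) := Nat.cast_pos.2 (NeZero.pos _)
  have hs : M.varFormula + 2 * M.covSumFormula = ((d * J : ℕ) : ℝ) * σ2 := by
    rw [hσ2, sigmaStarSq]
    field_simp
  -- The limit as `n → ∞` of `√(n / L) / √(n * σ2)`, where `L` is the block length.
  set c : ℕ → ℝ := fun b => (√(((b * (d * J) : ℕ) : ℝ) * σ2))⁻¹ with hc
  have hcb : Tendsto (fun b : ℕ => ((b * (d * J) : ℕ) : ℝ) * σ2) atTop atTop := by
    push_cast
    simp_rw [mul_assoc]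
    refine Tendsto.atTop_mul_const ?_ tendsto_natCast_atTop_atTop
    push_cast at hI
    rw [← mul_assoc]
    exact mul_pos hI hσ
  have hc0 : Tendsto c atTop (nhds 0) :=
    tendsto_inv_atTop_zero.comp (Real.tendsto_sqrt_atTop.comp hcb)
  have hv1 : Tendsto (fun b : ℕ => Var[fresh J R (b * (d * J)) 0; P] * (c b) ^ 2) atTop
      (nhds 1) := by
    have h1 := h.tendsto_variance_fresh.div_const (((d * J : ℕ) : ℝ) * σ2)
    rw [hs, div_self (by positivity)] at h1
    refine h1.congr fun b => ?_
    rw [hc]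
    simp only
    rw [inv_pow, Real.sq_sqrt (by positivity), Nat.cast_mul b, div_div, div_eq_mul_inv]
    congr 2
    ring
  have hg : Tendsto (fun b : ℕ => Complex.exp
      (-(Var[fresh J R (b * (d * J)) 0; P] * (c b * t) ^ 2 / 2 : ℝ))) atTop
      (nhds (Complex.exp (-(t ^ 2 / 2 : ℝ)))) := by
    refine (Complex.continuous_exp.tendsto _).comp ?_
    refine Tendsto.neg ((Complex.continuous_ofReal.tendsto _).comp ?_)
    have := (hv1.mul_const (t ^ 2)).div_const 2
    rw [one_mul] at this
    refine this.congr fun b => ?_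
    ring
  have hsmall : Tendsto (fun b : ℕ => |t| * (√C0 * c b)) atTop (nhds 0) := by
    have := (hc0.const_mul (√C0)).const_mul |t|
    simpa using this
  rw [Metric.tendsto_atTop']
  intro ε hε
  -- The block length is fixed first, such that the Gaussian limit of the fresh sums is within `ε /
  -- 3` of the target and the limiting error from the carries is below `ε / 3`. The last `ε / 3` is
  -- spent on `n → ∞` for this `b`.
  obtain ⟨b, hb, hb1, hb2⟩ := ((eventually_ge_atTop 1).and
    ((hg.eventually (Metric.ball_mem_nhds _ (show 0 < ε / 3 by positivity))).and
      (hsmall.eventually (gt_mem_nhds (show 0 < ε / 3 by positivity))))).exists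
  set L := b * (d * J) with hL
  have hLpos : 0 < L := Nat.mul_pos hb (NeZero.pos _)
  have hLpos' : (0 : ℝ) < L := by exact_mod_cast hLpos
  set v := Var[fresh J R L 0; P] with hv
  set e := ∫ ω, fresh J R L 0 ω ∂P with he
  obtain ⟨K, hK0, hK'⟩ := h.exists_integral_abs_machineSum_sub_le hb a j₀ hj
  set F : ℕ → Ω → ℝ := fun N ω => ∑ m ∈ Finset.range N, fresh J R L m ω - N * e with hF
  have hK : ∀ n : ℕ, ∫ ω, |(machineSum J (fun _ => j₀) R a n ω - n * M.muStar) - F (n / L) ω| ∂P ≤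
      K + √((n / L : ℕ) * C0) := hK'
  have hF2 : ∀ N, MemLp (F N) 2 P := fun N =>
    (memLp_finsetSum _ fun m _ => h.memLp_fresh L m).sub (memLp_const _)
  have hFabs : ∀ N, ∫ ω, |F N ω| ∂P ≤ √(N * v) := by
    intro N
    have := integral_abs_sub_integral_le
      (memLp_finsetSum (Finset.range N) fun m _ => h.memLp_fresh L m)
    rwa [h.integral_sum_fresh, h.variance_sum_fresh] at this
  have hdiv : Tendsto (fun n : ℕ => n / L) atTop atTop := Nat.tendsto_div_const_atTop hLpos.ne'
  have hY : Tendsto (fun n : ℕ => charFun (P.map fun ω => c b * ((√((n / L : ℕ) : ℝ))⁻¹ *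
      F (n / L) ω)) t) atTop (nhds (Complex.exp (-(v * (c b * t) ^ 2 / 2 : ℝ)))) := by
    have := (h.tendsto_charFun_fresh b (c b * t)).comp hdiv
    refine (this.congr fun n => ?_).trans_eq ?_
    · rw [Function.comp_apply, ← charFun_map_mul_comp]
      exact (((hF2 (n / L)).aemeasurable).const_mul _)
    · push_cast
      rfl
  set ρ : ℕ → ℝ := fun n => √((n / L : ℕ) : ℝ) / √(n * σ2) with hρ
  have hρ' : Tendsto ρ atTop (nhds (c b)) := by
    have h1 : Tendsto (fun n : ℕ => ((n / L : ℕ) : ℝ) / n) atTop (nhds (L : ℝ)⁻¹) := by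
      have := (tendsto_nat_floor_mul_div_atTop (R := ℝ) (a := (L : ℝ)⁻¹) (by positivity)).comp
        tendsto_natCast_atTop_atTop
      refine this.congr fun n => ?_
      rw [Function.comp_apply, inv_mul_eq_div, Nat.floor_div_natCast, Nat.floor_natCast]
    have h2 := (Real.continuous_sqrt.tendsto _).comp (h1.div_const σ2)
    have e2 : √((L : ℝ)⁻¹ / σ2) = c b := by
      rw [hc]
      simp only
      rw [← Real.sqrt_inv, mul_inv, ← div_eq_mul_inv]
    rw [e2] at h2
    refine h2.congr fun n => ?_
    rw [Function.comp_apply, hρ]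
    simp only
    rw [← Real.sqrt_div (Nat.cast_nonneg _), div_div]
  -- Three errors: bounded boundary terms, the carries, and the replacement of the ratio `ρ n` by
  -- its limit. Only the second survives as `n → ∞`.
  have hbound : ∀ᶠ n : ℕ in atTop, ‖charFun (P.map fun ω =>
        (machineSum J (fun _ => j₀) R a n ω - n * M.muStar) / √(n * σ2)) t -
      charFun (P.map fun ω => c b * ((√((n / L : ℕ) : ℝ))⁻¹ * F (n / L) ω)) t‖ ≤
      |t| * ((K / √(n * σ2) + √C0 * ρ n) + √v * |ρ n - c b|) := by
    filter_upwards [eventually_ge_atTop L, eventually_gt_atTop 0] with n hnL hn0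
    have hN0 : 0 < n / L := Nat.div_pos hnL hLpos
    have hN0' : (0 : ℝ) < √((n / L : ℕ) : ℝ) := Real.sqrt_pos.2 (by exact_mod_cast hN0)
    have hn0' : (0 : ℝ) < n := by exact_mod_cast hn0
    have hsq : 0 < √(n * σ2) := Real.sqrt_pos.2 (mul_pos hn0' hσ)
    have hM2 : MemLp (fun ω => machineSum J (fun _ => j₀) R a n ω - n * M.muStar) 2 P :=
      (h.memLp_machineSum measurable_const _ _).sub (memLp_const _)
    have hX2 : MemLp (fun ω => (machineSum J (fun _ => j₀) R a n ω - n * M.muStar) / √(n * σ2)) 2 P := by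
      simp_rw [div_eq_mul_inv]
      exact hM2.mul_const _
    have hY2 : MemLp (fun ω => c b * ((√((n / L : ℕ) : ℝ))⁻¹ * F (n / L) ω)) 2 P :=
      ((hF2 _).const_mul _).const_mul _
    refine (norm_charFun_map_sub_le hX2.aemeasurable hY2.aemeasurable
      ((hX2.sub hY2).integrable one_le_two) t).trans (mul_le_mul_of_nonneg_left ?_ (abs_nonneg t))
    have hid : ∀ ω, |(machineSum J (fun _ => j₀) R a n ω - n * M.muStar) / √(n * σ2) -
        c b * ((√((n / L : ℕ) : ℝ))⁻¹ * F (n / L) ω)| ≤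
        (√(n * σ2))⁻¹ * |(machineSum J (fun _ => j₀) R a n ω - n * M.muStar) - F (n / L) ω| +
          |ρ n - c b| * (√((n / L : ℕ) : ℝ))⁻¹ * |F (n / L) ω| := by
      intro ω
      have e1 : (machineSum J (fun _ => j₀) R a n ω - n * M.muStar) / √(n * σ2) -
          c b * ((√((n / L : ℕ) : ℝ))⁻¹ * F (n / L) ω) =
          (√(n * σ2))⁻¹ * ((machineSum J (fun _ => j₀) R a n ω - n * M.muStar) - F (n / L) ω) +
            (ρ n - c b) * (√((n / L : ℕ) : ℝ))⁻¹ * F (n / L) ω := by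
        rw [hρ]
        field_simp
        ring
      rw [e1]
      refine (abs_add_le _ _).trans (le_of_eq ?_)
      rw [abs_mul, abs_mul, abs_mul, abs_of_pos (inv_pos.2 hsq), abs_of_pos (inv_pos.2 hN0')]
    have iM : Integrable (fun ω =>
        |(machineSum J (fun _ => j₀) R a n ω - n * M.muStar) - F (n / L) ω|) P :=
      ((hM2.sub (hF2 _)).integrable one_le_two).abs
    have iF : Integrable (fun ω => |F (n / L) ω|) P := ((hF2 _).integrable one_le_two).abs
    refine (integral_mono ((hX2.sub hY2).integrable one_le_two).abs
      ((iM.const_mul _).add (iF.const_mul _)) hid).trans ?_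
    simp only [Pi.add_apply]
    rw [integral_add (iM.const_mul _) (iF.const_mul _), integral_const_mul, integral_const_mul]
    refine add_le_add ?_ ?_
    · refine (mul_le_mul_of_nonneg_left (hK n) (inv_nonneg.2 hsq.le)).trans (le_of_eq ?_)
      rw [Real.sqrt_mul (Nat.cast_nonneg (n / L)) C0, hρ]
      simp only
      field_simp
    · refine (mul_le_mul_of_nonneg_left (hFabs _) (by positivity)).trans (le_of_eq ?_)
      rw [Real.sqrt_mul (Nat.cast_nonneg (n / L)) v]
      field_simp
  have hlim : Tendsto (fun n : ℕ => |t| * ((K / √(n * σ2) + √C0 * ρ n) + √v * |ρ n - c b|)) atTop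
      (nhds (|t| * (√C0 * c b))) := by
    have h1 : Tendsto (fun n : ℕ => K / √(n * σ2)) atTop (nhds 0) :=
      tendsto_const_nhds.div_atTop (Real.tendsto_sqrt_atTop.comp
        (tendsto_natCast_atTop_atTop.atTop_mul_const hσ))
    have h2 := ((hρ'.sub_const (c b)).abs).const_mul (√v)
    rw [sub_self, abs_zero, mul_zero] at h2
    have := ((h1.add (hρ'.const_mul (√C0))).add h2).const_mul |t|
    rwa [zero_add, add_zero] at this
  have hfin := (hbound.and ((hlim.eventually (gt_mem_nhds hb2)).and
    (hY.eventually (Metric.ball_mem_nhds _ (show 0 < ε / 3 by positivity)))))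
  obtain ⟨n0, hn0⟩ := eventually_atTop.1 hfin
  refine ⟨n0, fun n hn => ?_⟩
  obtain ⟨k1, k2, k3⟩ := hn0 n hn.le
  have hb1' : dist (Complex.exp (-(v * (c b * t) ^ 2 / 2 : ℝ))) (Complex.exp (-(t ^ 2 / 2 : ℝ))) <
      ε / 3 := hb1
  rw [← dist_eq_norm] at k1
  refine (dist_triangle4 _ _ _ _).trans_lt (lt_of_lt_of_le
    (add_lt_add (add_lt_add (k1.trans_lt k2) k3) hb1') ?_)
  linarith

end IsBiinfinitePayouts

lemma IsPayoutsFrom.map_eq_infinitePi {i₀ : ZMod (d * J)} {r : ℕ → Ω → ℝ}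
    (h : M.IsPayoutsFrom i₀ P r) : P.map (fun ω n => r n ω) =
      Measure.infinitePi fun n : ℕ => M.law (i₀ + (n : ZMod (d * J))) := by
  rw [h.indep.map_fun_eq_infinitePi_map h.measurable]
  simp_rw [h.map_eq]

lemma IsBiinfinitePayouts.isPayoutsFrom (h : M.IsBiinfinitePayouts P R) (a : ℕ) :
    M.IsPayoutsFrom (a : ZMod (d * J)) P (fun n => R ((a : ℤ) + 1 + n)) where
  measurable n := h.measurable _
  indep := h.indep.precomp (g := fun n : ℕ => (a : ℤ) + 1 + n) fun x y hxy => by simpa using hxy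
  map_eq n := by
    rw [h.map_eq]
    congr 1
    push_cast
    ring

/-- The central limit theorem for the machine started in an arbitrary state. -/
lemma IsPayoutsFrom.tendstoInDistribution [IsProbabilityMeasure P] [NeZero (d * J)]
    (hσ : 0 < M.sigmaStarSq) {i₀ : ZMod (d * J)} {r : ℕ → Ω → ℝ} (h : M.IsPayoutsFrom i₀ P r)
    (j₀ : ℕ) (hj : j₀ < J) :
    TendstoInDistribution (fun (n : ℕ) (ω : Ω) =>
        ((∑ l ∈ Finset.range n, payoutStar J j₀ (fun k => r k ω) l) - n * M.muStar) /
          Real.sqrt (n * M.sigmaStarSq))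
      atTop (fun x : ℝ => x) (fun _ => P) (gaussianReal 0 1) := by
  set Ψ : ℕ → (ℕ → ℝ) → ℝ := fun n x =>
    ((∑ l ∈ Finset.range n, payoutStar J j₀ x l) - n * M.muStar) / √(n * M.sigmaStarSq) with hΨ
  have hΨm : ∀ n, Measurable (Ψ n) := fun n =>
    ((measurable_sum_payoutStar (y := fun _ => j₀) (r := fun k (x : ℕ → ℝ) => x k) measurable_const
      fun _ _ => measurable_pi_apply _).sub_const _).div_const _
  have hrm : Measurable fun ω n => r n ω := measurable_pi_lambda _ h.measurable
  -- Convergence in distribution involves only the law of the payouts, so they may be taken from the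
  -- canonical two-sided path, started at coup `i₀.val + 1`, where the cam is in position `i₀`.
  have hc := M.isBiinfinitePayouts_canonical
  have hf := hc.isPayoutsFrom i₀.val
  rw [ZMod.natCast_zmod_val] at hf
  have hlaw := h.map_eq_infinitePi.trans hf.map_eq_infinitePi.symm
  refine ⟨fun n => ((hΨm n).comp hrm).aemeasurable, by fun_prop, ?_⟩
  refine ProbabilityMeasure.tendsto_iff_tendsto_charFun.2 fun t => ?_
  simp only [ProbabilityMeasure.coe_mk, Measure.map_id', charFun_gaussianReal]
  have hlim := hc.tendsto_charFun_machineSum hσ i₀.val j₀ hj t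
  refine (hlim.congr fun n => ?_).trans_eq ?_
  · congr 1
    change Measure.map (Ψ n ∘ fun (x : ℤ → ℝ) (k : ℕ) => x ((i₀.val : ℤ) + 1 + k)) _ =
      Measure.map (Ψ n ∘ fun ω k => r k ω) P
    rw [← Measure.map_map (hΨm n) (measurable_pi_lambda _ hf.measurable),
      ← Measure.map_map (hΨm n) hrm, hlaw]
  · congr 2
    push_cast
    simp

end CentralLimit

end FuturityMachine

end

theorem theorem3 {d J : ℕ} (hd : 1 ≤ d) (hJ : 2 ≤ J) (M : FuturityMachine d J) :
    -- the variance parameter is the one of the stationary block sums, in explicit form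
    (∀ {Ω : Type*} [MeasurableSpace Ω] (P : Measure Ω) [IsProbabilityMeasure P] (R : ℤ → Ω → ℝ),
      M.IsBiinfinitePayouts P R →
        ∫ ω, FuturityMachine.blockStar d J R 0 ω ∂P = ((d * J : ℕ) : ℝ) * M.muStar ∧
        Var[FuturityMachine.blockStar d J R 0; P] = M.varFormula ∧
        HasSum
          (fun m : ℕ => cov[FuturityMachine.blockStar d J R 0,
            FuturityMachine.blockStar d J R ((m : ℤ) + 1); P])
          M.covSumFormula) ∧
    0 < M.sigmaStarSq ∧
    -- the central limit theorem from an arbitrary initial state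
    (∀ {Ω : Type*} [MeasurableSpace Ω] (P : Measure Ω) [IsProbabilityMeasure P]
      (i₀ : ZMod (d * J)) (j₀ : Fin J) (R : ℕ → Ω → ℝ),
      M.IsPayoutsFrom i₀ P R →
        TendstoInDistribution
          (fun (n : ℕ) (ω : Ω) =>
            ((∑ l ∈ Finset.range n,
                FuturityMachine.payoutStar J (j₀ : ℕ) (fun k => R k ω) l) - n * M.muStar) /
              Real.sqrt (n * M.sigmaStarSq))
          atTop (fun x : ℝ => x) (fun _ => P) (gaussianReal 0 1)) := by
  have : NeZero (d * J) := ⟨Nat.mul_ne_zero (by omega) (by omega)⟩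
  have hσ := M.sigmaStarSq_pos hJ
  refine ⟨fun P _ R h => ?_, hσ, fun P _ i₀ j₀ R h => h.tendstoInDistribution hσ j₀ j₀.isLt⟩
  exact ⟨h.integral_blockStar_zero, h.variance_blockStar_zero, h.hasSum_cov_blockStar⟩
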